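/- \textbf{Theorem (Scale invariant t-test extended martingale).} Let $X_1,X_2,\dots$ be real random variables and put $S_n=\sum_{i\le n}X_i$, $V_n=\sum_{i\le n}X_i^2$. Call a measurable function $f:\mathbb R^n\to\mathbb R$ scale invariant if $f(\lambda x)=f(x)$ for all $\lambda>0$, and let $\mathcal F_n^*=\sigma\big(f(X_1,\dots,X_n): f \text{ scale invariant}\big)$. A $[0,\infty]$-valued process $(M_n)_{n\ge n_0}$ is an extended nonnegative supermartingale (ENSM) for $P$ on a filtration $(\mathcal G_n)$ if each $M_n$ is $\mathcal G_n$-measurable and $E_P(M_{n+1}\mid\mathcal G_n)\le M_n$ almost surely for all $n\ge n_0$, with no integrability required; it is a nonnegative martingale (NM) if equality holds and $E_P(M_{n_0})<\infty$. Define $$H_1=\infty,\qquad H_n=\sqrt{\frac{2\pi}{n}}\left(\frac{nV_n}{nV_n-S_n^2}\right)^{n/2}\ (n\ge2),\qquad h_{\theta,n}=\frac{e^{-n\theta^2/2}}{\Gamma(n/2)}\int_0^\infty y^{n/2-1}\exp\Big\{-y+\theta S_n\sqrt{2y/V_n}\Big\}\,dy .$$ (1) If $X_1,X_2,\dots$ are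 i.i.d. $N(0,\sigma^2)$ with $\sigma>0$, then $(H_n)_{n\ge1}$ is an ENSM on $(\mathcal F_n^*)_{n\ge1}$. It is the flat (improper) mixture of the processes $(h_{\theta,n})_{n\ge1}$, $\theta\in\mathbb R$, each of which is an NM on $(\mathcal F^*_n)_{n\ge1}$: for every $n\ge1$, almost surely $H_n=\int_{\mathbb R}h_{\theta,n}\,d\theta$. It satisfies the extended Ville inequality: for every $m\ge1$ and $0<\varepsilon<\infty$, $$P(\exists n\ge m,\ H_n\ge\varepsilon)\le \varepsilon^{-1}E\big(\mathbf 1_{\{H_m<\varepsilon\}}H_m\big)+P(H_m\ge\varepsilon).$$ (2) (Lai's t-confidence sequence, obtained by applying this inequality.) Let $m\ge2$ be an integer and $a>0$, let $\overline X_n=S_n/n$, $s_n^2=\frac1n\sum_{i\le n}(X_i-\overline X_n)^2$, and $$b=\frac1m\Big(1+\frac{a^2}{m-1}\Big)^m,\qquad \xi_n=\sqrt{s_n^2\big[(bn)^{1/n}-1\big]},\qquad \mathrm{CI}_n=[\overline X_n-\xi_n,\ \overline X_n+\xi_n].$$ Let $X_1,X_2,\dots$ be i.i.d. $N(\mu,\sigma^2)$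 with $\mu\in\mathbb R$, $\sigma>0$, let $H_n^\mu$ be $H_n$ computed from the data $X_i-\mu$, and let $F_{m-1},f_{m-1}$ be the distribution function and the density of Student's t-distribution with $m-1$ degrees of freedom. Then for $n\ge m$ one has $\mu\notin\mathrm{CI}_n$ if and only if $H_n^\mu>\varepsilon:=\sqrt{2\pi b}$ (with the quotient in $H_n^\mu$ read as $c/0=\infty$ for $c>0$ and $0/0=0$), and $$P(\exists n\ge m,\ \mu\notin \mathrm{CI}_n)\le \varepsilon^{-1}E\big(\mathbf 1_{\{H^\mu_m<\varepsilon\}}H^\mu_m\big)+P(H^\mu_m\ge\varepsilon)\le 2\big(1-F_{m-1}(a)+a f_{m-1}(a)\big).$$ -/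

import Mathlib

open MeasureTheory ProbabilityTheory
open scoped ENNReal NNReal

namespace TTest

/-- The processes of this file are functions of a data stream. The observations `X₁, X₂, …` are
`x 0, x 1, …`, so that the first `n` observations are `x i` with `i < n`. Partial sum `Sₙ`. -/
noncomputable def pSum (n : ℕ) (x : ℕ → ℝ) : ℝ := ∑ i ∈ Finset.range n, x i

/-- Partial sum of squares `Vₙ`. -/
noncomputable def pSumSq (n : ℕ) (x : ℕ → ℝ) : ℝ := ∑ i ∈ Finset.range n, x i ^ 2

/-- Sample average. -/
noncomputable def avg (n : ℕ) (x : ℕ → ℝ) : ℝ := pSum n x / n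

/-- Sample variance `sₙ²` (without Bessel's correction). -/
noncomputable def sampleVar (n : ℕ) (x : ℕ → ℝ) : ℝ :=
  (∑ i ∈ Finset.range n, (x i - avg n x) ^ 2) / n

/-- A measurable function on `ℝⁿ` that does not change under rescaling by a positive constant. -/
def IsScaleInvariant {n : ℕ} (f : (Fin n → ℝ) → ℝ) : Prop :=
  Measurable f ∧ ∀ (c : ℝ), 0 < c → ∀ x : Fin n → ℝ, f (fun i => c * x i) = f x

/-- The σ-algebra `Fₙ* = σ(f(X₁, …, Xₙ) : f is scale invariant)`. -/
@[reducible]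
def scaleInvSigma {Ω : Type*} (X : ℕ → Ω → ℝ) (n : ℕ) : MeasurableSpace Ω :=
  ⨆ (f : (Fin n → ℝ) → ℝ) (_ : IsScaleInvariant f),
    MeasurableSpace.comap (fun ω => f (fun i => X i ω)) inferInstance

/-- The scale invariant filtration of the data `X`. -/
def scaleInvFiltration {Ω : Type*} [mΩ : MeasurableSpace Ω] (X : ℕ → Ω → ℝ)
    (hX : ∀ i, Measurable (X i)) : Filtration ℕ mΩ where
  seq := scaleInvSigma X
  mono' := by
    refine monotone_nat_of_le_succ fun n => ?_
    refine iSup₂_le fun f hf => ?_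
    have hg : IsScaleInvariant (fun x : Fin (n + 1) → ℝ => f (fun i => x i.castSucc)) :=
      ⟨hf.1.comp (by fun_prop), fun c hc x => hf.2 c hc (fun i => x i.castSucc)⟩
    exact le_iSup₂_of_le (f := fun (g : (Fin (n + 1) → ℝ) → ℝ) (_ : IsScaleInvariant g) =>
      MeasurableSpace.comap (fun ω => g (fun i => X i ω)) inferInstance) _ hg le_rfl
  le' := by
    intro n
    refine iSup₂_le fun f hf => ?_
    exact (hf.1.comp (measurable_pi_lambda _ fun i => hX i)).comap_le

/-- The process `(Mₙ)`, `n ≥ n₀`, is an extended nonnegative supermartingale for `P` on `G`: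
it is adapted and `E[Mₙ₊₁ | Gₙ] ≤ Mₙ` almost surely. No integrability is required; the
conditional expectation is that of `[0, ∞]`-valued functions. -/
structure IsENSM {Ω : Type*} [mΩ : MeasurableSpace Ω] (P : Measure Ω) (G : Filtration ℕ mΩ)
    (n₀ : ℕ) (M : ℕ → Ω → ℝ≥0∞) : Prop where
  adapted : ∀ n, n₀ ≤ n → Measurable[G n] (M n)
  condExp_le : ∀ n, n₀ ≤ n → condLExp (G n) P (M (n + 1)) ≤ᵐ[P] M n

/-- The process `(Mₙ)`, `n ≥ n₀`, is a nonnegative martingale for `P` on `G`. -/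
structure IsNM {Ω : Type*} [mΩ : MeasurableSpace Ω] (P : Measure Ω) (G : Filtration ℕ mΩ)
    (n₀ : ℕ) (M : ℕ → Ω → ℝ≥0∞) : Prop where
  integrable : ∫⁻ ω, M n₀ ω ∂P < ∞
  adapted : ∀ n, n₀ ≤ n → Measurable[G n] (M n)
  condExp_eq : ∀ n, n₀ ≤ n → condLExp (G n) P (M (n + 1)) =ᵐ[P] M n

/-- The bound of the extended Ville inequality, for the process started at time `m` and
the level `ε`: `ε⁻¹ E[1_{M_m < ε} M_m] + P(M_m ≥ ε)`. -/
noncomputable def villeBound {Ω : Type*} [MeasurableSpace Ω] (P : Measure Ω)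
    (M : ℕ → Ω → ℝ≥0∞) (m : ℕ) (ε : ℝ≥0∞) : ℝ≥0∞ :=
  ε⁻¹ * ∫⁻ ω in {ω | M m ω < ε}, M m ω ∂P + P {ω | ε ≤ M m ω}

/-- Under `P`, the sequence `X` is i.i.d. `N(μ, v)`, where `v` is the variance. -/
structure IsIIDGaussian {Ω : Type*} [MeasurableSpace Ω] (P : Measure Ω) (X : ℕ → Ω → ℝ)
    (μ : ℝ) (v : ℝ≥0) : Prop where
  indep : iIndepFun X P
  law : ∀ i, HasLaw (X i) (gaussianReal μ v) P

/-- The process `Hₙ = √(2π/n) (n Vₙ / (n Vₙ - Sₙ²))^{n/2}` for `n ≥ 2`, and `H₁ = ∞`. The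
quotient is taken in `[0, ∞]`, so that `c / 0 = ∞` for `c > 0`. -/
noncomputable def tENSM (n : ℕ) (x : ℕ → ℝ) : ℝ≥0∞ :=
  if n ≤ 1 then ∞ else
    ENNReal.ofReal (Real.sqrt (2 * Real.pi / n)) *
      (ENNReal.ofReal (n * pSumSq n x) / ENNReal.ofReal (n * pSumSq n x - pSum n x ^ 2))
        ^ ((n : ℝ) / 2)

/-- The scale invariant t-likelihood ratio
`h_{θ,n} = e^{-nθ²/2} / Γ(n/2) ∫_{y > 0} y^{n/2-1} exp(-y + θ Sₙ √(2y/Vₙ)) dy`. -/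
noncomputable def tLR (θ : ℝ) (n : ℕ) (x : ℕ → ℝ) : ℝ≥0∞ :=
  ENNReal.ofReal (Real.exp (-(n * θ ^ 2 / 2)) / Real.Gamma ((n : ℝ) / 2)) *
    ∫⁻ y in Set.Ioi (0 : ℝ), ENNReal.ofReal
      (y ^ ((n : ℝ) / 2 - 1) * Real.exp (-y + θ * pSum n x * Real.sqrt (2 * y / pSumSq n x)))

/-- Density of Student's t-distribution with `k` degrees of freedom. -/
noncomputable def tPDF (k t : ℝ) : ℝ :=
  Real.Gamma ((k + 1) / 2) / (Real.sqrt (k * Real.pi) * Real.Gamma (k / 2)) *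
    (1 + t ^ 2 / k) ^ (-((k + 1) / 2))

/-- Distribution function of Student's t-distribution with `k` degrees of freedom. -/
noncomputable def tCDF (k a : ℝ) : ℝ := ∫ t in Set.Iic a, tPDF k t

/-- The constant `b = (1/m) (1 + a²/(m-1))^m`. -/
noncomputable def laiB (m : ℕ) (a : ℝ) : ℝ := 1 / m * (1 + a ^ 2 / ((m : ℝ) - 1)) ^ m

/-- The radius `ξₙ = √(sₙ² [(b n)^{1/n} - 1])`. -/
noncomputable def laiRadius (m : ℕ) (a : ℝ) (n : ℕ) (x : ℕ → ℝ) : ℝ :=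
  Real.sqrt (sampleVar n x * ((laiB m a * n) ^ (1 / (n : ℝ)) - 1))

/-- Lai's interval: sample average plus or minus the radius. -/
noncomputable def laiCI (m : ℕ) (a : ℝ) (n : ℕ) (x : ℕ → ℝ) : Set ℝ :=
  Set.Icc (avg n x - laiRadius m a n x) (avg n x + laiRadius m a n x)

end TTest

/-!
A scale invariant function of the data only sees the ray through the data. So the likelihood ratio
of two laws on the scale invariant σ-algebra is the ratio of the integrals of their densities along
that ray, against the invariant measure `ds / s` (Wijsman's formula). For `N(θ, 1)` against
`N(0, 1)` this ratio is `h_θ`; being a likelihood ratio of restrictions to a filtration, it is a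
martingale, and integrating the Gaussian ray integrals over `θ` gives `H`. The supermartingale
property of `H` and the extended Ville inequality need no integrability: the former is Tonelli's
theorem, and the latter a sum over the first time at which the level is reached.

For Lai's sequence, the law of the t-statistic `T` of the first `m` observations has density
`f_{m-1}`, and `H_m = √(2π b(T))` is a constant multiple of `1 / f_{m-1}(T)`. Hence the bound of the
extended Ville inequality at the level `ε = √(2π b(a))` is
`E[min(H_m / ε, 1)] = ∫ min(f_{m-1}(a), f_{m-1}(t)) dt`.
-/

namespace TTest

section ConeSigma

variable {E : Type*} [MeasurableSpace E] [SMul ℝ E]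

variable (E) in
/-- The σ-algebra of the measurable cones, that is, of the measurable sets which are stable under
rescaling by positive constants. It is the σ-algebra of the scale invariant functions. -/
@[reducible]
def coneSigma : MeasurableSpace E where
  MeasurableSet' A := MeasurableSet A ∧ ∀ c : ℝ, 0 < c → ∀ x : E, c • x ∈ A ↔ x ∈ A
  measurableSet_empty := ⟨MeasurableSet.empty, fun _ _ _ => Iff.rfl⟩
  measurableSet_compl _ hA := ⟨hA.1.compl, fun c hc x => not_congr (hA.2 c hc x)⟩
  measurableSet_iUnion A hA := ⟨MeasurableSet.iUnion fun i => (hA i).1, fun c hc x => by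
    simp only [Set.mem_iUnion, fun i => (hA i).2 c hc x]⟩

lemma coneSigma_le : coneSigma E ≤ ‹MeasurableSpace E› := fun _ hA => hA.1

lemma measurable_coneSigma_iff {β : Type*} [MeasurableSpace β] [MeasurableSingletonClass β]
    {g : E → β} :
    Measurable[coneSigma E] g ↔ Measurable g ∧ ∀ c : ℝ, 0 < c → ∀ x, g (c • x) = g x := by
  refine ⟨fun hg => ⟨hg.mono coneSigma_le le_rfl, fun c hc x => ?_⟩, fun hg s hs => ⟨hg.1 hs, ?_⟩⟩
  · exact ((hg (measurableSet_singleton (g x))).2 c hc x).mpr rfl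
  · exact fun c hc x => by rw [Set.mem_preimage, Set.mem_preimage, hg.2 c hc x]

end ConeSigma

lemma scaleInvSigma_eq_comap {Ω : Type*} (X : ℕ → Ω → ℝ) (n : ℕ) :
    scaleInvSigma X n = (coneSigma (Fin n → ℝ)).comap fun ω (i : Fin n) => X i ω := by
  apply le_antisymm
  · refine iSup₂_le fun f hf => ?_
    have hf_cone : Measurable[coneSigma (Fin n → ℝ)] f := measurable_coneSigma_iff.mpr hf
    rw [← Function.comp_def f, ← MeasurableSpace.comap_comp]
    exact MeasurableSpace.comap_mono hf_cone.comap_le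
  · rintro _ ⟨A, hA, rfl⟩
    have hf : IsScaleInvariant (A.indicator fun _ => (1 : ℝ)) :=
      ⟨measurable_const.indicator hA.1, fun c hc x =>
        Set.indicator_const_eq_indicator_const (hA.2 c hc x)⟩
    refine le_iSup₂_of_le (f := fun (g : (Fin n → ℝ) → ℝ) (_ : IsScaleInvariant g) =>
      MeasurableSpace.comap (fun ω => g fun i => X i ω) inferInstance) _ hf le_rfl _ ?_
    refine ⟨{1}, measurableSet_singleton 1, ?_⟩
    ext ω
    simp

section Ville

variable {Ω : Type*} [mΩ : MeasurableSpace Ω] {P : Measure Ω} {G : Filtration ℕ mΩ} {n₀ : ℕ}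
  {M : ℕ → Ω → ℝ≥0∞}

lemma IsENSM.measurable (hM : IsENSM P G n₀ M) {n : ℕ} (hn : n₀ ≤ n) : Measurable (M n) :=
  (hM.adapted n hn).mono (G.le n) le_rfl

variable [SigmaFiniteFiltration P G]

lemma IsENSM.setLIntegral_succ_le (hM : IsENSM P G n₀ M) {n : ℕ} (hn : n₀ ≤ n) {s : Set Ω}
    (hs : MeasurableSet[G n] s) : ∫⁻ ω in s, M (n + 1) ω ∂P ≤ ∫⁻ ω in s, M n ω ∂P := by
  rw [← setLIntegral_condLExp (G.le n) P _ hs]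
  exact lintegral_mono_ae (ae_restrict_of_ae (hM.condExp_le n hn))

lemma IsENSM.mul_measure_inter_exists_add_le (hM : IsENSM P G n₀ M) {m : ℕ} (hm : n₀ ≤ m)
    (N : ℕ) {s : Set Ω} (hs : MeasurableSet[G m] s) (ε : ℝ≥0∞) :
    ε * P (s ∩ {ω | ∃ n, m ≤ n ∧ n ≤ m + N ∧ ε ≤ M n ω}) ≤ ∫⁻ ω in s, M m ω ∂P := by
  induction N generalizing m s with
  | zero =>
    have hset : {ω | ∃ n, m ≤ n ∧ n ≤ m + 0 ∧ ε ≤ M n ω} = {ω | ε ≤ M m ω} := by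
      ext ω
      exact ⟨fun ⟨n, h₁, h₂, h⟩ => (le_antisymm h₁ h₂ : m = n) ▸ h, fun h => ⟨m, le_rfl, le_rfl, h⟩⟩
    rw [hset, Set.inter_comm, ← Measure.restrict_apply' (G.le m _ hs)]
    exact mul_meas_ge_le_lintegral (hM.measurable hm) ε
  | succ N ih =>
    set t := {ω | ε ≤ M m ω}
    have ht : MeasurableSet[G m] t := hM.adapted m hm measurableSet_Ici
    have hcover : s ∩ {ω | ∃ n, m ≤ n ∧ n ≤ m + (N + 1) ∧ ε ≤ M n ω} ⊆
        s ∩ t ∪ s \ t ∩ {ω | ∃ n, m + 1 ≤ n ∧ n ≤ m + 1 + N ∧ ε ≤ M n ω} := by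
      rintro ω ⟨hω, n, h₁, h₂, h⟩
      by_cases hωt : ω ∈ t
      · exact .inl ⟨hω, hωt⟩
      · have hne : m ≠ n := by rintro rfl; exact hωt h
        exact .inr ⟨⟨hω, hωt⟩, n, by lia, by lia, h⟩
    have hnow : ε * P (s ∩ t) ≤ ∫⁻ ω in s ∩ t, M m ω ∂P := by
      rw [← setLIntegral_const]
      exact setLIntegral_mono (hM.measurable hm) fun ω hω => hω.2
    have hlater := (ih (hm.trans m.le_succ) (G.mono m.le_succ _ (hs.diff ht))).trans
      (hM.setLIntegral_succ_le hm (hs.diff ht))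
    calc _ ≤ ε * P (s ∩ t) + ε * P (s \ t ∩ _) := by
          rw [← mul_add]
          exact mul_le_mul_right ((measure_mono hcover).trans (measure_union_le _ _)) ε
      _ ≤ _ := add_le_add hnow hlater
      _ = ∫⁻ ω in s, M m ω ∂P := lintegral_inter_add_sdiff _ s (G.le m _ ht)

lemma IsENSM.mul_measure_inter_exists_ge_le (hM : IsENSM P G n₀ M) {m : ℕ} (hm : n₀ ≤ m)
    {s : Set Ω} (hs : MeasurableSet[G m] s) (ε : ℝ≥0∞) :
    ε * P (s ∩ {ω | ∃ n, m ≤ n ∧ ε ≤ M n ω}) ≤ ∫⁻ ω in s, M m ω ∂P := by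
  have hUnion : s ∩ {ω | ∃ n, m ≤ n ∧ ε ≤ M n ω} =
      ⋃ N, s ∩ {ω | ∃ n, m ≤ n ∧ n ≤ m + N ∧ ε ≤ M n ω} := by
    ext ω
    simp only [Set.mem_inter_iff, Set.mem_iUnion, exists_and_left, Set.mem_ofPred_eq]
    exact and_congr_right fun _ =>
      ⟨fun ⟨n, hmn, h⟩ => ⟨n, n, hmn, by lia, h⟩, fun ⟨_, n, hmn, _, h⟩ => ⟨n, hmn, h⟩⟩
  have hmono : Monotone fun N => s ∩ {ω | ∃ n, m ≤ n ∧ n ≤ m + N ∧ ε ≤ M n ω} :=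
    fun N N' h => Set.inter_subset_inter_right s fun ω ⟨n, h₁, h₂, h₃⟩ => ⟨n, h₁, by lia, h₃⟩
  rw [hUnion, hmono.measure_iUnion, ENNReal.mul_iSup]
  exact iSup_le fun N => hM.mul_measure_inter_exists_add_le hm N hs ε

theorem IsENSM.measure_exists_ge_le_villeBound (hM : IsENSM P G n₀ M) {m : ℕ} (hm : n₀ ≤ m)
    {ε : ℝ≥0∞} (h0 : ε ≠ 0) (htop : ε ≠ ∞) :
    P {ω | ∃ n, m ≤ n ∧ ε ≤ M n ω} ≤ villeBound P M m ε := by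
  set s := {ω | M m ω < ε}
  set t := {ω | ∃ n, m ≤ n ∧ ε ≤ M n ω}
  have hs : MeasurableSet[G m] s := hM.adapted m hm measurableSet_Iio
  have hcrossing : P (s ∩ t) ≤ ε⁻¹ * ∫⁻ ω in s, M m ω ∂P := by
    rw [← ENNReal.div_eq_inv_mul, ENNReal.le_div_iff_mul_le (.inl h0) (.inl htop), mul_comm]
    exact hM.mul_measure_inter_exists_ge_le hm hs ε
  have hcover : t ⊆ s ∩ t ∪ {ω | ε ≤ M m ω} := fun ω hω =>
    (lt_or_ge (M m ω) ε).imp (fun h => ⟨h, hω⟩) id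
  exact (measure_mono hcover).trans ((measure_union_le _ _).trans (add_le_add_left hcrossing _))

end Ville

section PosHaar

/-- The measure `dt / t` on the positive half-line, the Haar measure of the group of rescalings. -/
noncomputable def posHaar : Measure ℝ :=
  (volume.restrict (Set.Ioi 0)).withDensity fun t => ENNReal.ofReal t⁻¹

instance : SFinite posHaar := by
  unfold posHaar
  infer_instance

lemma lintegral_posHaar (f : ℝ → ℝ≥0∞) :
    ∫⁻ t, f t ∂posHaar = ∫⁻ t in Set.Ioi 0, ENNReal.ofReal t⁻¹ * f t :=
  lintegral_withDensity_eq_lintegral_mul_non_measurable _ (by fun_prop)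
    (ae_of_all _ fun _ => ENNReal.ofReal_lt_top) f

lemma lintegral_posHaar_congr {f g : ℝ → ℝ≥0∞} (h : ∀ t, 0 < t → f t = g t) :
    ∫⁻ t, f t ∂posHaar = ∫⁻ t, g t ∂posHaar := by
  simp_rw [lintegral_posHaar]
  exact setLIntegral_congr_fun measurableSet_Ioi fun t ht => by rw [h t ht]

lemma lintegral_posHaar_comp_mul_rpow {c p : ℝ} (hc : 0 < c) (hp : p ≠ 0) (f : ℝ → ℝ≥0∞) :
    ENNReal.ofReal |p| * ∫⁻ t, f (c * t ^ p) ∂posHaar = ∫⁻ t, f t ∂posHaar := by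
  have himage : (fun t : ℝ => c * t ^ p) '' Set.Ioi 0 = Set.Ioi 0 := by
    ext u
    constructor
    · rintro ⟨t, ht : 0 < t, rfl⟩
      exact mul_pos hc (Real.rpow_pos_of_pos ht p)
    · intro (hu : 0 < u)
      refine ⟨(u / c) ^ p⁻¹, Real.rpow_pos_of_pos (div_pos hu hc) _, ?_⟩
      simp only
      rw [Real.rpow_inv_rpow (div_pos hu hc).le hp, mul_div_cancel₀ u hc.ne']
  have hderiv : ∀ t ∈ Set.Ioi (0 : ℝ),
      HasDerivWithinAt (fun t => c * t ^ p) (c * (p * t ^ (p - 1))) (Set.Ioi 0) t := fun t ht =>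
    ((Real.hasDerivAt_rpow_const (.inl (ne_of_gt ht))).const_mul c).hasDerivWithinAt
  have hinj : Set.InjOn (fun t : ℝ => c * t ^ p) (Set.Ioi 0) :=
    fun s (hs : 0 < s) t (ht : 0 < t) hst =>
      Real.rpow_left_injOn hp hs.le ht.le (mul_left_cancel₀ hc.ne' hst)
  have hsubst := lintegral_image_eq_lintegral_abs_deriv_mul measurableSet_Ioi hderiv hinj
    fun u => ENNReal.ofReal u⁻¹ * f u
  rw [lintegral_posHaar f, ← himage, hsubst, lintegral_posHaar,
    ← lintegral_const_mul' _ _ ENNReal.ofReal_ne_top]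
  refine setLIntegral_congr_fun measurableSet_Ioi fun t (ht : 0 < t) => ?_
  rw [← mul_assoc, ← mul_assoc, ← ENNReal.ofReal_mul (abs_nonneg _),
    ← ENNReal.ofReal_mul (abs_nonneg _), abs_mul, abs_mul, abs_of_pos hc,
    abs_of_pos (Real.rpow_pos_of_pos ht _), Real.rpow_sub_one ht.ne']
  have := (Real.rpow_pos_of_pos ht p).ne'
  congr 2
  field_simp

lemma lintegral_posHaar_comp_inv (f : ℝ → ℝ≥0∞) :
    ∫⁻ t, f t⁻¹ ∂posHaar = ∫⁻ t, f t ∂posHaar := by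
  simpa [Real.rpow_neg_one] using
    lintegral_posHaar_comp_mul_rpow one_pos (neg_ne_zero.mpr one_ne_zero) f

lemma lintegral_posHaar_comp_mul {c : ℝ} (hc : 0 < c) (f : ℝ → ℝ≥0∞) :
    ∫⁻ t, f (c * t) ∂posHaar = ∫⁻ t, f t ∂posHaar := by
  simpa using lintegral_posHaar_comp_mul_rpow hc one_ne_zero f

lemma lintegral_posHaar_rpow (s : ℝ) : ∫⁻ t, ENNReal.ofReal (t ^ s) ∂posHaar = ∞ := by
  have hae : ∀ᵐ t ∂volume.restrict (Set.Ioi (0 : ℝ)), 0 ≤ t ^ (s - 1) := by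
    filter_upwards [ae_restrict_mem measurableSet_Ioi] with t ht
    exact Real.rpow_nonneg (le_of_lt ht) _
  have hnot : ¬ HasFiniteIntegral (fun t : ℝ => t ^ (s - 1)) (volume.restrict (Set.Ioi 0)) :=
    fun h => not_integrableOn_Ioi_rpow (s - 1) ⟨by fun_prop, h⟩
  rw [hasFiniteIntegral_iff_ofReal hae, not_lt, top_le_iff] at hnot
  rw [lintegral_posHaar, ← hnot]
  refine setLIntegral_congr_fun measurableSet_Ioi fun t (ht : 0 < t) => ?_
  rw [← ENNReal.ofReal_mul (by positivity), Real.rpow_sub_one ht.ne', div_eq_inv_mul]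

lemma lintegral_posHaar_rpow_mul_exp_neg {s p r : ℝ} (hs : 0 < s) (hp : 0 < p) (hr : 0 ≤ r) :
    ∫⁻ t, ENNReal.ofReal (t ^ s * Real.exp (-(r * t ^ p))) ∂posHaar =
      ENNReal.ofReal (Real.Gamma (s / p) / p) * ENNReal.ofReal r ^ (-(s / p)) := by
  have hsp : 0 < s / p := div_pos hs hp
  have hcoef : 0 < Real.Gamma (s / p) / p := div_pos (Real.Gamma_pos_of_pos hsp) hp
  rcases hr.eq_or_lt with rfl | hr
  · rw [ENNReal.ofReal_zero, ENNReal.zero_rpow_of_neg (neg_neg_of_pos hsp),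
      ENNReal.mul_top (ENNReal.ofReal_pos.mpr hcoef).ne', ← lintegral_posHaar_rpow s]
    simp only [zero_mul, neg_zero, Real.exp_zero, mul_one]
  have hintegrand : ∀ t ∈ Set.Ioi (0 : ℝ),
      ENNReal.ofReal t⁻¹ * ENNReal.ofReal (t ^ s * Real.exp (-(r * t ^ p))) =
        ENNReal.ofReal (t ^ (s - 1) * Real.exp (-r * t ^ p)) := fun t (ht : 0 < t) => by
    rw [← ENNReal.ofReal_mul (by positivity), Real.rpow_sub_one ht.ne', neg_mul]
    congr 1
    ring
  rw [lintegral_posHaar, setLIntegral_congr_fun measurableSet_Ioi hintegrand,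
    ← ofReal_integral_eq_lintegral_ofReal
      (integrableOn_rpow_mul_exp_neg_mul_rpow (by linarith) hp hr),
    integral_rpow_mul_exp_neg_mul_rpow hp (by linarith) hr, sub_add_cancel,
    ENNReal.ofReal_rpow_of_pos hr, ← ENNReal.ofReal_mul (by positivity), neg_div]
  · congr 1
    ring
  · filter_upwards [ae_restrict_mem measurableSet_Ioi] with t (ht : 0 < t)
    exact mul_nonneg (Real.rpow_nonneg ht.le _) (Real.exp_pos _).le

end PosHaar

section RayIntegral

open Module (finrank)

variable {E : Type*} [NormedAddCommGroup E] [NormedSpace ℝ E]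

/-- The integral `∫ t ^ d f (t x) dt / t` of `f` over the ray through `x`, where `d` is the
dimension: up to a change of the base point on the ray, this is the density at the ray of the
image, in the space of rays, of the measure with density `f`. -/
noncomputable def rayIntegral (f : E → ℝ≥0∞) (x : E) : ℝ≥0∞ :=
  ∫⁻ t, ENNReal.ofReal (t ^ finrank ℝ E) * f (t • x) ∂posHaar

lemma rayIntegral_smul (f : E → ℝ≥0∞) {c : ℝ} (hc : 0 < c) (x : E) :
    ENNReal.ofReal (c ^ finrank ℝ E) * rayIntegral f (c • x) = rayIntegral f x := by
  rw [rayIntegral, rayIntegral,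
    ← lintegral_posHaar_comp_mul hc fun t => ENNReal.ofReal _ * f (t • x),
    ← lintegral_const_mul' _ _ ENNReal.ofReal_ne_top]
  refine lintegral_congr fun t => ?_
  rw [mul_pow, ENNReal.ofReal_mul (by positivity), mul_assoc, smul_smul, mul_comm t c]

lemma indicator_inv_rayIntegral_smul (f : E → ℝ≥0∞) {A : Set E}
    (hA : ∀ c : ℝ, 0 < c → ∀ x, c • x ∈ A ↔ x ∈ A) {c : ℝ} (hc : 0 < c) (x : E) :
    A.indicator (fun x => (rayIntegral f x)⁻¹) (c • x) = ENNReal.ofReal (c ^ finrank ℝ E) *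
      A.indicator (fun x => (rayIntegral f x)⁻¹) x := by
  have hc0 : ENNReal.ofReal (c ^ finrank ℝ E) ≠ 0 := by positivity
  by_cases hx : x ∈ A
  · rw [Set.indicator_of_mem ((hA c hc x).mpr hx), Set.indicator_of_mem hx,
      ← rayIntegral_smul f hc x, ENNReal.mul_inv (.inl hc0) (.inl ENNReal.ofReal_ne_top),
      ENNReal.mul_inv_cancel_left hc0 ENNReal.ofReal_ne_top]
  · rw [Set.indicator_of_notMem (mt (hA c hc x).mp hx), Set.indicator_of_notMem hx, mul_zero]

variable [MeasurableSpace E] [BorelSpace E] [FiniteDimensional ℝ E]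

lemma measurable_rayIntegral {f : E → ℝ≥0∞} (hf : Measurable f) : Measurable (rayIntegral f) := by
  unfold rayIntegral
  fun_prop

variable {μ : Measure E} [μ.IsAddHaarMeasure]

lemma lintegral_comp_smul_addHaar {f : E → ℝ≥0∞} (hf : Measurable f) {c : ℝ} (hc : 0 < c) :
    ∫⁻ x, f (c • x) ∂μ = ENNReal.ofReal (c⁻¹ ^ finrank ℝ E) * ∫⁻ x, f x ∂μ := by
  rw [← lintegral_map hf (measurable_const_smul c), Measure.map_addHaar_smul μ hc.ne',
    lintegral_smul_measure, smul_eq_mul, abs_of_pos (by positivity), inv_pow]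

lemma lintegral_mul_rayIntegral_comm {h a b : E → ℝ≥0∞} (hh : Measurable h) (ha : Measurable a)
    (hb : Measurable b) (hhom : ∀ c : ℝ, 0 < c → ∀ x,
      h (c • x) = ENNReal.ofReal (c ^ finrank ℝ E) * h x) :
    ∫⁻ x, h x * (a x * rayIntegral b x) ∂μ = ∫⁻ x, h x * (rayIntegral a x * b x) ∂μ := by
  calc ∫⁻ x, h x * (a x * rayIntegral b x) ∂μ
      = ∫⁻ x, ∫⁻ t, a x * (h (t • x) * b (t • x)) ∂posHaar ∂μ := by
        refine lintegral_congr fun x => ?_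
        rw [rayIntegral, ← mul_assoc, ← lintegral_const_mul _ (by fun_prop)]
        refine lintegral_posHaar_congr fun t ht => ?_
        rw [hhom t ht]
        ring
    _ = ∫⁻ t, ∫⁻ x, a x * (h (t • x) * b (t • x)) ∂μ ∂posHaar :=
        lintegral_lintegral_swap (by fun_prop)
    _ = ∫⁻ t, ∫⁻ x, ENNReal.ofReal (t⁻¹ ^ finrank ℝ E) *
          (a (t⁻¹ • x) * (h x * b x)) ∂μ ∂posHaar := by
        refine lintegral_posHaar_congr fun t ht => ?_
        rw [lintegral_const_mul _ (by fun_prop), ← lintegral_comp_smul_addHaar (by fun_prop) ht]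
        simp_rw [inv_smul_smul₀ ht.ne']
    _ = ∫⁻ t, ∫⁻ x, ENNReal.ofReal (t ^ finrank ℝ E) * (a (t • x) * (h x * b x)) ∂μ ∂posHaar :=
        lintegral_posHaar_comp_inv fun t =>
          ∫⁻ x, ENNReal.ofReal (t ^ finrank ℝ E) * (a (t • x) * (h x * b x)) ∂μ
    _ = ∫⁻ x, ∫⁻ t, ENNReal.ofReal (t ^ finrank ℝ E) * (a (t • x) * (h x * b x)) ∂posHaar ∂μ :=
        lintegral_lintegral_swap (by fun_prop)
    _ = ∫⁻ x, h x * (rayIntegral a x * b x) ∂μ := by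
        refine lintegral_congr fun x => ?_
        rw [mul_left_comm, rayIntegral, ← lintegral_mul_const _ (by fun_prop)]
        simp_rw [mul_assoc]

theorem setLIntegral_rayIntegral_div_rayIntegral {p q : E → ℝ≥0∞} (hp : Measurable p)
    (hq : Measurable q) (hp0 : ∀ᵐ x ∂μ, rayIntegral p x ≠ 0) (hptop : ∀ᵐ x ∂μ, rayIntegral p x ≠ ∞)
    {A : Set E} (hA : MeasurableSet[coneSigma E] A) :
    ∫⁻ x in A, rayIntegral q x / rayIntegral p x ∂μ.withDensity p = μ.withDensity q A := by
  have hRp := measurable_rayIntegral hp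
  have hRq := measurable_rayIntegral hq
  let h : E → ℝ≥0∞ := A.indicator fun x => (rayIntegral p x)⁻¹
  calc ∫⁻ x in A, rayIntegral q x / rayIntegral p x ∂μ.withDensity p
      = ∫⁻ x, h x * (p x * rayIntegral q x) ∂μ := by
        rw [restrict_withDensity hA.1, lintegral_withDensity_eq_lintegral_mul _ hp (by fun_prop),
          ← lintegral_indicator hA.1]
        refine lintegral_congr fun x => ?_
        by_cases hx : x ∈ A
        · simp only [h, Set.indicator_of_mem hx, Pi.mul_apply, ENNReal.div_eq_inv_mul]
          ring
        · simp only [h, Set.indicator_of_notMem hx, zero_mul]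
    _ = ∫⁻ x, h x * (rayIntegral p x * q x) ∂μ :=
        lintegral_mul_rayIntegral_comm (hRp.inv.indicator hA.1) hp hq
          fun c hc => indicator_inv_rayIntegral_smul p hA.2 hc
    _ = ∫⁻ x, A.indicator q x ∂μ := by
        refine lintegral_congr_ae ?_
        filter_upwards [hp0, hptop] with x hx0 hxtop
        by_cases hx : x ∈ A
        · simp only [h, Set.indicator_of_mem hx]
          rw [ENNReal.inv_mul_cancel_left hx0 hxtop]
        · simp only [h, Set.indicator_of_notMem hx, zero_mul]
    _ = μ.withDensity q A := by rw [lintegral_indicator hA.1, withDensity_apply q hA.1]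

end RayIntegral

section RayIntegralExp

open Module (finrank)

variable {E : Type*} [NormedAddCommGroup E] [NormedSpace ℝ E]

lemma rayIntegral_const_mul {c : ℝ≥0∞} (hc : c ≠ ∞) (f : E → ℝ≥0∞) (x : E) :
    rayIntegral (fun x => c * f x) x = c * rayIntegral f x := by
  unfold rayIntegral
  rw [← lintegral_const_mul' _ _ hc]
  simp_rw [mul_left_comm]

lemma rayIntegral_exp_neg_half [FiniteDimensional ℝ E] [Nontrivial E] {Q : E → ℝ}
    (hQ : ∀ (t : ℝ) (x : E), Q (t • x) = t ^ 2 * Q x) {x : E} (hx : 0 ≤ Q x) :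
    rayIntegral (fun x => ENNReal.ofReal (Real.exp (-(Q x / 2)))) x =
      ENNReal.ofReal (Real.Gamma (finrank ℝ E / 2) / 2) *
        ENNReal.ofReal (Q x / 2) ^ (-((finrank ℝ E : ℝ) / 2)) := by
  have hd : (0 : ℝ) < finrank ℝ E := Nat.cast_pos.mpr Module.finrank_pos
  rw [← lintegral_posHaar_rpow_mul_exp_neg hd two_pos (by positivity)]
  refine lintegral_posHaar_congr fun t ht => ?_
  rw [← ENNReal.ofReal_mul (by positivity), hQ, Real.rpow_natCast, Real.rpow_ofNat]
  congr 3
  ring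

end RayIntegralExp

section SampleMoments

variable {n : ℕ}

/-- The data stream which starts with the observations `x` and vanishes afterwards. It allows to
evaluate the functions of the first `n` observations of a stream at the points of `ℝⁿ`. -/
noncomputable def zeroExtend (x : Fin n → ℝ) : ℕ → ℝ := Function.extend Fin.val x 0

lemma zeroExtend_apply (x : Fin n → ℝ) (i : Fin n) : zeroExtend x i = x i :=
  Fin.val_injective.extend_apply x 0 i

lemma pSum_zeroExtend (x : Fin n → ℝ) : pSum n (zeroExtend x) = ∑ i, x i := by
  simp_rw [pSum, ← Fin.sum_univ_eq_sum_range, zeroExtend_apply]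

lemma pSumSq_zeroExtend (x : Fin n → ℝ) : pSumSq n (zeroExtend x) = ∑ i, x i ^ 2 := by
  simp_rw [pSumSq, ← Fin.sum_univ_eq_sum_range (fun i => zeroExtend x i ^ 2), zeroExtend_apply]

lemma pSum_zeroExtend_restrict (x : ℕ → ℝ) : pSum n (zeroExtend fun i : Fin n => x i) = pSum n x :=
  (pSum_zeroExtend _).trans (Fin.sum_univ_eq_sum_range x n)

lemma pSumSq_zeroExtend_restrict (x : ℕ → ℝ) :
    pSumSq n (zeroExtend fun i : Fin n => x i) = pSumSq n x :=
  (pSumSq_zeroExtend _).trans (Fin.sum_univ_eq_sum_range (fun i => x i ^ 2) n)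

lemma tENSM_zeroExtend_restrict (x : ℕ → ℝ) :
    tENSM n (zeroExtend fun i : Fin n => x i) = tENSM n x := by
  unfold tENSM
  rw [pSum_zeroExtend_restrict, pSumSq_zeroExtend_restrict]

lemma tLR_zeroExtend_restrict (θ : ℝ) (x : ℕ → ℝ) :
    tLR θ n (zeroExtend fun i : Fin n => x i) = tLR θ n x := by
  unfold tLR
  rw [pSum_zeroExtend_restrict, pSumSq_zeroExtend_restrict]

lemma pSum_zeroExtend_smul (c : ℝ) (x : Fin n → ℝ) :
    pSum n (zeroExtend (c • x)) = c * pSum n (zeroExtend x) := by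
  simp only [pSum_zeroExtend, Pi.smul_apply, smul_eq_mul, Finset.mul_sum]

lemma pSumSq_zeroExtend_smul (c : ℝ) (x : Fin n → ℝ) :
    pSumSq n (zeroExtend (c • x)) = c ^ 2 * pSumSq n (zeroExtend x) := by
  simp only [pSumSq_zeroExtend, Pi.smul_apply, smul_eq_mul, mul_pow, Finset.mul_sum]

lemma pSumSq_nonneg (n : ℕ) (x : ℕ → ℝ) : 0 ≤ pSumSq n x :=
  Finset.sum_nonneg fun _ _ => sq_nonneg _

lemma pSumSq_zeroExtend_pos {x : Fin n → ℝ} (hx : x ≠ 0) : 0 < pSumSq n (zeroExtend x) := by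
  obtain ⟨i, hi⟩ := Function.ne_iff.mp hx
  rw [pSumSq_zeroExtend]
  exact Finset.sum_pos' (fun i _ => sq_nonneg _) ⟨i, Finset.mem_univ i, sq_pos_of_ne_zero hi⟩

@[fun_prop]
lemma measurable_pSum_zeroExtend : Measurable fun x : Fin n → ℝ => pSum n (zeroExtend x) := by
  simp_rw [pSum_zeroExtend]
  fun_prop

@[fun_prop]
lemma measurable_pSumSq_zeroExtend : Measurable fun x : Fin n → ℝ => pSumSq n (zeroExtend x) := by
  simp_rw [pSumSq_zeroExtend]
  fun_prop

lemma measurable_coneSigma_tENSM :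
    Measurable[coneSigma (Fin n → ℝ)] fun x => tENSM n (zeroExtend x) := by
  refine measurable_coneSigma_iff.mpr ⟨?_, fun c hc x => ?_⟩ <;> unfold tENSM <;> split_ifs
  · exact measurable_const
  · fun_prop
  · rfl
  · have hc2 : 0 < c ^ 2 := by positivity
    rw [pSum_zeroExtend_smul, pSumSq_zeroExtend_smul, mul_pow, mul_left_comm, ← mul_sub,
      ENNReal.ofReal_mul hc2.le, ENNReal.ofReal_mul hc2.le,
      ENNReal.mul_div_mul_left _ _ (ENNReal.ofReal_pos.mpr hc2).ne' ENNReal.ofReal_ne_top]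

lemma measurable_coneSigma_tLR (θ : ℝ) :
    Measurable[coneSigma (Fin n → ℝ)] fun x => tLR θ n (zeroExtend x) := by
  refine measurable_coneSigma_iff.mpr ⟨?_, fun c hc x => ?_⟩ <;> unfold tLR
  · simp_rw [pSum_zeroExtend, pSumSq_zeroExtend]
    fun_prop
  · have hratio : ∀ y : ℝ, c * pSum n (zeroExtend x) * √(2 * y / (c ^ 2 * pSumSq n (zeroExtend x)))
        = pSum n (zeroExtend x) * √(2 * y / pSumSq n (zeroExtend x)) := fun y => by
      rw [mul_comm (c ^ 2), ← div_div, Real.sqrt_div' _ (sq_nonneg c), Real.sqrt_sq hc.le]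
      field_simp
    simp_rw [pSum_zeroExtend_smul, pSumSq_zeroExtend_smul, mul_assoc θ, hratio]

lemma card_mul_sampleVar (n : ℕ) (x : ℕ → ℝ) :
    n * sampleVar n x = pSumSq n x - pSum n x ^ 2 / n := by
  rcases n.eq_zero_or_pos with rfl | hn
  · simp [pSumSq]
  simp only [sampleVar, avg, sub_sq, Finset.sum_add_distrib, Finset.sum_sub_distrib,
    Finset.sum_const, Finset.card_range, nsmul_eq_mul, ← Finset.sum_mul, ← Finset.mul_sum]
  change n * ((pSumSq n x - 2 * pSum n x * (pSum n x / n) + n * (pSum n x / n) ^ 2) / n) = _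
  field_simp
  ring

lemma sampleVar_nonneg (n : ℕ) (x : ℕ → ℝ) : 0 ≤ sampleVar n x :=
  div_nonneg (Finset.sum_nonneg fun _ _ => sq_nonneg _) n.cast_nonneg

lemma sampleVar_add_sq_avg (n : ℕ) (x : ℕ → ℝ) :
    sampleVar n x + avg n x ^ 2 = pSumSq n x / n := by
  rcases n.eq_zero_or_pos with rfl | hn
  · simp [sampleVar, avg]
  have hvar := card_mul_sampleVar n x
  rw [avg]
  field_simp at hvar ⊢
  linarith

lemma tENSM_eq_sampleVar (hn : 0 < n) {x : ℕ → ℝ} (hx : n = 1 → pSumSq n x ≠ 0) :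
    tENSM n x = ENNReal.ofReal √(2 * Real.pi / n) *
      (ENNReal.ofReal (sampleVar n x + avg n x ^ 2) / ENNReal.ofReal (sampleVar n x)) ^
        ((n : ℝ) / 2) := by
  have hn2 : (0 : ℝ) < (n : ℝ) ^ 2 := by positivity
  rw [tENSM]
  split_ifs with h
  · obtain rfl : n = 1 := by lia
    have hvar : sampleVar 1 x = 0 := by simp [sampleVar, avg, pSum]
    have hpos : 0 < pSumSq 1 x := (pSumSq_nonneg 1 x).lt_of_ne' (hx rfl)
    rw [sampleVar_add_sq_avg, hvar, ENNReal.ofReal_zero, Nat.cast_one, div_one, div_one,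
      ENNReal.div_zero (ENNReal.ofReal_pos.mpr hpos).ne', ENNReal.top_rpow_of_pos (by norm_num),
      ENNReal.mul_top (ENNReal.ofReal_pos.mpr (by positivity)).ne']
  · have hnum : n * pSumSq n x = n ^ 2 * (sampleVar n x + avg n x ^ 2) := by
      rw [sampleVar_add_sq_avg]
      field_simp
    have hden : n * pSumSq n x - pSum n x ^ 2 = n ^ 2 * sampleVar n x := by
      rw [sq (n : ℝ), mul_assoc, card_mul_sampleVar]
      field_simp
    rw [hden, hnum, ENNReal.ofReal_mul hn2.le, ENNReal.ofReal_mul hn2.le,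
      ENNReal.mul_div_mul_left _ _ (ENNReal.ofReal_pos.mpr hn2).ne' ENNReal.ofReal_ne_top]

end SampleMoments

section Product

variable {n : ℕ} {α : Fin n → Type*} [∀ i, MeasurableSpace (α i)] (μ : ∀ i, Measure (α i))
  [∀ i, SigmaFinite (μ i)] {f : ∀ i, α i → ℝ≥0∞}

lemma lintegral_pi_prod (hf : ∀ i, Measurable (f i)) :
    ∫⁻ x, ∏ i, f i (x i) ∂Measure.pi μ = ∏ i, ∫⁻ t, f i t ∂μ i := by
  induction n with
  | zero => simp
  | succ n ih =>
    have hsplit := (measurePreserving_piFinSuccAbove μ 0).symm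
    rw [← hsplit.lintegral_comp_emb (MeasurableEquiv.measurableEmbedding _), Fin.prod_univ_succ,
      ← ih (fun i => μ i.succ) fun i => hf i.succ,
      ← lintegral_prod_mul (hf 0).aemeasurable (Finset.measurable_fun_prod _ fun i _ =>
        (hf i.succ).comp (measurable_pi_apply i)).aemeasurable]
    refine lintegral_congr fun z => ?_
    rw [Fin.prod_univ_succ]
    rfl

lemma pi_withDensity (hf : ∀ i, Measurable (f i)) [∀ i, SigmaFinite ((μ i).withDensity (f i))] :
    Measure.pi (fun i => (μ i).withDensity (f i)) =
      (Measure.pi μ).withDensity fun x => ∏ i, f i (x i) := by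
  refine Measure.pi_eq fun s hs => ?_
  have hindicator : ∀ x, (Set.univ.pi s).indicator (fun x => ∏ i, f i (x i)) x =
      ∏ i, (s i).indicator (f i) (x i) := fun x => by
    by_cases hx : x ∈ Set.univ.pi s
    · rw [Set.indicator_of_mem hx]
      exact Finset.prod_congr rfl fun i _ => (Set.indicator_of_mem (hx i trivial) _).symm
    · rw [Set.indicator_of_notMem hx]
      obtain ⟨i, hi⟩ : ∃ i, x i ∉ s i := by simpa using hx
      exact (Finset.prod_eq_zero (Finset.mem_univ i) (Set.indicator_of_notMem hi _)).symm
  rw [withDensity_apply _ (.univ_pi hs), ← lintegral_indicator (.univ_pi hs)]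
  simp_rw [hindicator, lintegral_pi_prod μ fun i => (hf i).indicator (hs i),
    lintegral_indicator (hs _), withDensity_apply _ (hs _)]

end Product

section GaussianPi

variable {n : ℕ}

/-- The law of `n` independent observations from `N(θ, 1)`. -/
noncomputable def gaussianPi (n : ℕ) (θ : ℝ) : Measure (Fin n → ℝ) :=
  Measure.pi fun _ => gaussianReal θ 1

instance (n : ℕ) (θ : ℝ) : IsProbabilityMeasure (gaussianPi n θ) := by
  unfold gaussianPi
  infer_instance

/-- The Lebesgue density of `gaussianPi n θ`. -/
noncomputable def gaussianPiPDF (θ : ℝ) (x : Fin n → ℝ) : ℝ≥0∞ := ∏ i, gaussianPDF θ 1 (x i)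

@[fun_prop]
lemma measurable_gaussianPiPDF {α : Type*} [MeasurableSpace α] {θ : α → ℝ} {f : α → Fin n → ℝ}
    (hθ : Measurable θ) (hf : Measurable f) : Measurable fun a => gaussianPiPDF (θ a) (f a) := by
  unfold gaussianPiPDF gaussianPDF gaussianPDFReal
  fun_prop

lemma gaussianPi_eq_withDensity (n : ℕ) (θ : ℝ) :
    gaussianPi n θ = volume.withDensity (gaussianPiPDF θ) := by
  have hpdf : gaussianReal θ 1 = volume.withDensity (gaussianPDF θ 1) :=
    gaussianReal_of_var_ne_zero θ one_ne_zero
  have : SigmaFinite ((volume : Measure ℝ).withDensity (gaussianPDF θ 1)) := by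
    rw [← hpdf]
    infer_instance
  rw [gaussianPi, hpdf, pi_withDensity _ fun _ => measurable_gaussianPDF θ 1]
  rfl

lemma gaussianPiPDF_eq (θ : ℝ) (x : Fin n → ℝ) :
    gaussianPiPDF θ x = ENNReal.ofReal ((√(2 * Real.pi))⁻¹ ^ n) *
      ENNReal.ofReal (Real.exp (θ * pSum n (zeroExtend x) - n * θ ^ 2 / 2
        - pSumSq n (zeroExtend x) / 2)) := by
  have hexponent : ∑ i, -(x i - θ) ^ 2 / 2 = θ * pSum n (zeroExtend x) - n * θ ^ 2 / 2
      - pSumSq n (zeroExtend x) / 2 := by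
    rw [← Finset.sum_div, Finset.sum_neg_distrib]
    simp only [sub_sq, Finset.sum_add_distrib, Finset.sum_sub_distrib, pSum_zeroExtend,
      pSumSq_zeroExtend, ← Finset.sum_mul, ← Finset.mul_sum, Finset.sum_const, Finset.card_univ,
      Fintype.card_fin, nsmul_eq_mul]
    ring
  simp_rw [gaussianPiPDF, gaussianPDF]
  rw [← ENNReal.ofReal_mul (by positivity),
    ← ENNReal.ofReal_prod_of_nonneg fun i _ => gaussianPDFReal_nonneg θ 1 (x i)]
  simp only [gaussianPDFReal, Finset.prod_mul_distrib, ← Real.exp_sum, Finset.prod_const,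
    Finset.card_univ, Fintype.card_fin, NNReal.coe_one, mul_one, hexponent]

lemma rayIntegral_gaussianPiPDF (θ : ℝ) (x : Fin n → ℝ) :
    rayIntegral (gaussianPiPDF θ) x =
      ENNReal.ofReal ((√(2 * Real.pi))⁻¹ ^ n) * ENNReal.ofReal (Real.exp (-(n * θ ^ 2 / 2))) *
        ∫⁻ t, ENNReal.ofReal (t ^ n * Real.exp (-(t ^ 2 * (pSumSq n (zeroExtend x) / 2))
          + θ * pSum n (zeroExtend x) * t)) ∂posHaar := by
  rw [rayIntegral, ← lintegral_const_mul' _ _ (by finiteness)]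
  refine lintegral_posHaar_congr fun t ht => ?_
  have hexp : Real.exp (θ * (t * pSum n (zeroExtend x)) - n * θ ^ 2 / 2
      - t ^ 2 * pSumSq n (zeroExtend x) / 2) = Real.exp (-(n * θ ^ 2 / 2)) *
        Real.exp (-(t ^ 2 * (pSumSq n (zeroExtend x) / 2)) + θ * pSum n (zeroExtend x) * t) := by
    rw [← Real.exp_add]
    ring_nf
  rw [gaussianPiPDF_eq, Module.finrank_fin_fun, pSum_zeroExtend_smul, pSumSq_zeroExtend_smul,
    hexp, ENNReal.ofReal_mul (Real.exp_pos _).le, ENNReal.ofReal_mul (pow_nonneg ht.le n)]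
  ring

lemma rayIntegral_gaussianPiPDF_zero {x : Fin n → ℝ} (hx : x ≠ 0) :
    rayIntegral (gaussianPiPDF 0) x = ENNReal.ofReal ((√(2 * Real.pi))⁻¹ ^ n) *
      (ENNReal.ofReal (Real.Gamma (n / 2) / 2) *
        ENNReal.ofReal (pSumSq n (zeroExtend x) / 2) ^ (-((n : ℝ) / 2))) := by
  have : Nontrivial (Fin n → ℝ) := nontrivial_of_ne x 0 hx
  have hpdf : (gaussianPiPDF 0 : (Fin n → ℝ) → ℝ≥0∞) = fun x =>
      ENNReal.ofReal ((√(2 * Real.pi))⁻¹ ^ n) *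
        ENNReal.ofReal (Real.exp (-(pSumSq n (zeroExtend x) / 2))) := by
    ext x
    simp [gaussianPiPDF_eq]
  rw [hpdf, rayIntegral_const_mul ENNReal.ofReal_ne_top,
    rayIntegral_exp_neg_half (Q := fun x : Fin n → ℝ => pSumSq n (zeroExtend x))
      pSumSq_zeroExtend_smul (pSumSq_nonneg _ _), Module.finrank_fin_fun]

end GaussianPi

section LikelihoodRatio

variable {n : ℕ} {x : Fin n → ℝ}

lemma pos_of_pi_ne_zero (hx : x ≠ 0) : 0 < n :=
  Nat.pos_of_ne_zero fun h => hx (by subst h; exact Subsingleton.elim x 0)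

lemma rayIntegral_gaussianPiPDF_zero_ne_zero (hx : x ≠ 0) :
    rayIntegral (gaussianPiPDF 0) x ≠ 0 := by
  have hn := pos_of_pi_ne_zero hx
  have hV := pSumSq_zeroExtend_pos hx
  rw [rayIntegral_gaussianPiPDF_zero hx, ENNReal.ofReal_rpow_of_pos (by positivity)]
  positivity

lemma rayIntegral_gaussianPiPDF_zero_ne_top (hx : x ≠ 0) : rayIntegral (gaussianPiPDF 0) x ≠ ∞ := by
  have hV := pSumSq_zeroExtend_pos hx
  rw [rayIntegral_gaussianPiPDF_zero hx, ENNReal.ofReal_rpow_of_pos (by positivity)]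
  finiteness

lemma lintegral_Ioi_rpow_sub_one_mul {s c : ℝ} (hc : 0 < c) (g : ℝ → ℝ) :
    ∫⁻ y in Set.Ioi 0, ENNReal.ofReal (y ^ (s - 1) * g y) =
      2 * ENNReal.ofReal c ^ s * ∫⁻ t, ENNReal.ofReal (t ^ (2 * s) * g (c * t ^ 2)) ∂posHaar := by
  calc _ = ∫⁻ y, ENNReal.ofReal (y ^ s * g y) ∂posHaar := by
        rw [lintegral_posHaar]
        refine setLIntegral_congr_fun measurableSet_Ioi fun y (hy : 0 < y) => ?_
        rw [← ENNReal.ofReal_mul (by positivity), Real.rpow_sub_one hy.ne', div_eq_inv_mul,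
          mul_assoc]
    _ = _ := by
        rw [← lintegral_posHaar_comp_mul_rpow hc two_ne_zero, abs_two, ENNReal.ofReal_ofNat,
          mul_assoc, ENNReal.ofReal_rpow_of_pos hc,
          ← lintegral_const_mul' _ _ ENNReal.ofReal_ne_top]
        congr 1
        refine lintegral_posHaar_congr fun t ht => ?_
        rw [← ENNReal.ofReal_mul (by positivity), Real.mul_rpow hc.le (by positivity),
          ← Real.rpow_mul ht.le, Real.rpow_ofNat, mul_assoc]

theorem tLR_zeroExtend (θ : ℝ) (hx : x ≠ 0) :
    tLR θ n (zeroExtend x) =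
      rayIntegral (gaussianPiPDF θ) x / rayIntegral (gaussianPiPDF 0) x := by
  set S := pSum n (zeroExtend x)
  set V := pSumSq n (zeroExtend x)
  have hV : 0 < V := pSumSq_zeroExtend_pos hx
  have hn := pos_of_pi_ne_zero hx
  have hintegral : ∫⁻ t, ENNReal.ofReal (t ^ (2 * ((n : ℝ) / 2)) *
      Real.exp (-(V / 2 * t ^ 2) + θ * S * √(2 * (V / 2 * t ^ 2) / V))) ∂posHaar =
      ∫⁻ t, ENNReal.ofReal (t ^ n * Real.exp (-(t ^ 2 * (V / 2)) + θ * S * t)) ∂posHaar := by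
    refine lintegral_posHaar_congr fun t ht => ?_
    rw [mul_div_cancel₀ _ two_ne_zero, Real.rpow_natCast, ← mul_assoc,
      mul_div_cancel₀ _ two_ne_zero, mul_div_cancel_left₀ _ hV.ne', Real.sqrt_sq ht.le,
      mul_comm (t ^ 2)]
  have hconst : ENNReal.ofReal (Real.Gamma (n / 2) / 2) * ENNReal.ofReal (V / 2) ^ (-((n : ℝ) / 2))
      * (ENNReal.ofReal (Real.exp (-(n * θ ^ 2 / 2)) / Real.Gamma (n / 2)) *
        (2 * ENNReal.ofReal (V / 2) ^ ((n : ℝ) / 2))) =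
      ENNReal.ofReal (Real.exp (-(n * θ ^ 2 / 2))) := by
    rw [← ENNReal.ofReal_ofNat 2, ENNReal.ofReal_rpow_of_pos (by positivity),
      ENNReal.ofReal_rpow_of_pos (by positivity), ← ENNReal.ofReal_mul (by positivity),
      ← ENNReal.ofReal_mul (by positivity), ← ENNReal.ofReal_mul (by positivity),
      ← ENNReal.ofReal_mul (by positivity), Real.rpow_neg (by positivity)]
    congr 1
    field_simp
  rw [ENNReal.eq_div_iff (rayIntegral_gaussianPiPDF_zero_ne_zero hx)
    (rayIntegral_gaussianPiPDF_zero_ne_top hx), rayIntegral_gaussianPiPDF_zero hx, tLR,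
    rayIntegral_gaussianPiPDF,
    lintegral_Ioi_rpow_sub_one_mul (half_pos hV) fun y => Real.exp (-y + θ * S * √(2 * y / V)),
    hintegral, ← hconst]
  ring

lemma lintegral_exp_mul_sub_sq {r : ℝ} (hr : 0 < r) (b : ℝ) :
    ∫⁻ θ : ℝ, ENNReal.ofReal (Real.exp (θ * b - r * θ ^ 2 / 2)) =
      ENNReal.ofReal (√(2 * Real.pi / r) * Real.exp (b ^ 2 / (2 * r))) := by
  let w : ℝ≥0 := ⟨1 / r, by positivity⟩
  have hw : w ≠ 0 := fun h => (one_div_pos.mpr hr).ne' (congrArg NNReal.toReal h)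
  have hcompleteSquare : ∀ θ : ℝ, ENNReal.ofReal (Real.exp (θ * b - r * θ ^ 2 / 2)) =
      ENNReal.ofReal (√(2 * Real.pi / r) * Real.exp (b ^ 2 / (2 * r))) *
        ENNReal.ofReal (gaussianPDFReal (b / r) w θ) := fun θ => by
    have hsqrt : √(2 * Real.pi / r) ≠ 0 := by positivity
    rw [← ENNReal.ofReal_mul (by positivity), gaussianPDFReal, show (w : ℝ) = 1 / r from rfl,
      mul_one_div, mul_mul_mul_comm, mul_inv_cancel₀ hsqrt, one_mul, ← Real.exp_add]
    congr 2
    field_simp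
    ring
  simp_rw [hcompleteSquare]
  rw [lintegral_const_mul _ (by fun_prop), lintegral_gaussianPDFReal_eq_one _ hw, mul_one]

lemma lintegral_gaussianPiPDF (hn : 0 < n) (x : Fin n → ℝ) :
    ∫⁻ θ, gaussianPiPDF θ x =
      ENNReal.ofReal ((√(2 * Real.pi))⁻¹ ^ n) * ENNReal.ofReal √(2 * Real.pi / n) *
        ENNReal.ofReal (Real.exp (-(n * sampleVar n (zeroExtend x) / 2))) := by
  have hn' : (0 : ℝ) < n := Nat.cast_pos.mpr hn
  have hvar := card_mul_sampleVar n (zeroExtend x)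
  simp_rw [gaussianPiPDF_eq]
  rw [lintegral_const_mul _ (by fun_prop), mul_assoc]
  congr 1
  simp_rw [sub_eq_add_neg _ (pSumSq n _ / 2), Real.exp_add, ENNReal.ofReal_mul (Real.exp_pos _).le]
  rw [lintegral_mul_const _ (by fun_prop), lintegral_exp_mul_sub_sq hn',
    ENNReal.ofReal_mul (by positivity), mul_assoc, ← ENNReal.ofReal_mul (by positivity),
    ← Real.exp_add, hvar]
  congr 3
  field_simp
  ring

lemma rayIntegral_lintegral_gaussianPiPDF (hx : x ≠ 0) :
    rayIntegral (fun x => ∫⁻ θ, gaussianPiPDF θ x) x =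
      ENNReal.ofReal ((√(2 * Real.pi))⁻¹ ^ n) * ENNReal.ofReal √(2 * Real.pi / n) *
        (ENNReal.ofReal (Real.Gamma (n / 2) / 2) *
          ENNReal.ofReal (n * sampleVar n (zeroExtend x) / 2) ^ (-((n : ℝ) / 2))) := by
  have : Nontrivial (Fin n → ℝ) := nontrivial_of_ne x 0 hx
  have hhom : ∀ (t : ℝ) (x : Fin n → ℝ),
      n * sampleVar n (zeroExtend (t • x)) = t ^ 2 * (n * sampleVar n (zeroExtend x)) :=
    fun t x => by
      rw [card_mul_sampleVar, card_mul_sampleVar, pSum_zeroExtend_smul, pSumSq_zeroExtend_smul]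
      ring
  simp_rw [lintegral_gaussianPiPDF (pos_of_pi_ne_zero hx)]
  rw [rayIntegral_const_mul (by finiteness), rayIntegral_exp_neg_half
    (Q := fun x : Fin n → ℝ => n * sampleVar n (zeroExtend x)) hhom
    (mul_nonneg n.cast_nonneg (sampleVar_nonneg _ _)), Module.finrank_fin_fun]

theorem lintegral_tLR_zeroExtend (hx : x ≠ 0) :
    ∫⁻ θ, tLR θ n (zeroExtend x) = tENSM n (zeroExtend x) := by
  have hn := pos_of_pi_ne_zero hx
  have hn2 : (0 : ℝ) < n / 2 := half_pos (Nat.cast_pos.mpr hn)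
  have hmixture : ∫⁻ θ, rayIntegral (gaussianPiPDF θ) x =
      rayIntegral (fun x => ∫⁻ θ, gaussianPiPDF θ x) x := by
    simp_rw [rayIntegral]
    rw [lintegral_lintegral_swap (by fun_prop)]
    simp_rw [lintegral_const_mul' _ _ ENNReal.ofReal_ne_top]
  have hratio : (ENNReal.ofReal (pSumSq n (zeroExtend x) / n) /
      ENNReal.ofReal (sampleVar n (zeroExtend x))) ^ ((n : ℝ) / 2) =
      ENNReal.ofReal (n * sampleVar n (zeroExtend x) / 2) ^ (-((n : ℝ) / 2)) /
        ENNReal.ofReal (pSumSq n (zeroExtend x) / 2) ^ (-((n : ℝ) / 2)) := by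
    have hV : pSumSq n (zeroExtend x) / 2 = n / 2 * (pSumSq n (zeroExtend x) / n) := by field_simp
    rw [ENNReal.rpow_neg, ENNReal.rpow_neg, div_eq_mul_inv _ (_⁻¹), inv_inv,
      ← ENNReal.div_eq_inv_mul, ← ENNReal.div_rpow_of_nonneg _ _ hn2.le, mul_div_right_comm, hV,
      ENNReal.ofReal_mul hn2.le, ENNReal.ofReal_mul hn2.le,
      ENNReal.mul_div_mul_left _ _ (ENNReal.ofReal_pos.mpr hn2).ne'
        ENNReal.ofReal_ne_top]
  simp_rw [tLR_zeroExtend _ hx, ENNReal.div_eq_inv_mul]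
  rw [lintegral_const_mul' _ _ (ENNReal.inv_ne_top.mpr (rayIntegral_gaussianPiPDF_zero_ne_zero hx)),
    hmixture, ← ENNReal.div_eq_inv_mul, rayIntegral_lintegral_gaussianPiPDF hx,
    rayIntegral_gaussianPiPDF_zero hx,
    tENSM_eq_sampleVar hn fun _ => (pSumSq_zeroExtend_pos hx).ne', sampleVar_add_sq_avg, hratio,
    mul_assoc, ENNReal.mul_div_mul_left _ _ (by positivity) ENNReal.ofReal_ne_top, mul_left_comm,
    ENNReal.mul_div_mul_left _ _ (by positivity) ENNReal.ofReal_ne_top, mul_div_assoc]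

end LikelihoodRatio

section Law

variable {n : ℕ}

lemma ae_ne_zero_gaussianPi (hn : 0 < n) (θ : ℝ) : ∀ᵐ x ∂gaussianPi n θ, x ≠ 0 := by
  have : NeZero n := ⟨hn.ne'⟩
  rw [gaussianPi_eq_withDensity]
  exact (withDensity_absolutelyContinuous _ _).ae_le (Measure.ae_ne volume 0)

lemma setLIntegral_tLR_gaussianPi (hn : 0 < n) (θ : ℝ) {A : Set (Fin n → ℝ)}
    (hA : MeasurableSet[coneSigma (Fin n → ℝ)] A) :
    ∫⁻ x in A, tLR θ n (zeroExtend x) ∂gaussianPi n 0 = gaussianPi n θ A := by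
  have : NeZero n := ⟨hn.ne'⟩
  have hne : ∀ᵐ x : Fin n → ℝ, x ≠ 0 := Measure.ae_ne volume 0
  calc _ = ∫⁻ x in A, rayIntegral (gaussianPiPDF θ) x / rayIntegral (gaussianPiPDF 0) x
        ∂gaussianPi n 0 := by
        refine lintegral_congr_ae (ae_restrict_of_ae ?_)
        filter_upwards [ae_ne_zero_gaussianPi hn 0] with x hx using tLR_zeroExtend θ hx
    _ = gaussianPi n θ A := by
        rw [gaussianPi_eq_withDensity, gaussianPi_eq_withDensity]
        refine setLIntegral_rayIntegral_div_rayIntegral (by fun_prop) (by fun_prop) ?_ ?_ hA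
        · filter_upwards [hne] with x hx using rayIntegral_gaussianPiPDF_zero_ne_zero hx
        · filter_upwards [hne] with x hx using rayIntegral_gaussianPiPDF_zero_ne_top hx

lemma gaussianPi_map_castSucc (n : ℕ) (θ : ℝ) :
    (gaussianPi (n + 1) θ).map (fun x (i : Fin n) => x i.castSucc) = gaussianPi n θ := by
  have hind := (iIndepFun_pi (μ := fun _ : Fin (n + 1) => gaussianReal θ 1) (X := fun _ t => t)
    fun _ => aemeasurable_id).precomp (Fin.castSucc_injective n)
  rw [gaussianPi, hind.map_fun_eq_pi_map fun i => (measurable_pi_apply _).aemeasurable]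
  congr 1
  ext1 i
  exact (measurePreserving_eval (fun _ : Fin (n + 1) => gaussianReal θ 1) i.castSucc).map_eq

lemma pi_gaussianReal_zero_eq_map (n : ℕ) (v : ℝ≥0) :
    Measure.pi (fun _ : Fin n => gaussianReal 0 v) = (gaussianPi n 0).map (√v • ·) := by
  have hscale : gaussianReal 0 v = (gaussianReal 0 1).map (√v * ·) := by
    rw [gaussianReal_map_const_mul, mul_zero, mul_one]
    congr
    ext
    simp
  have : SigmaFinite ((gaussianReal 0 1).map (√v * ·)) := by
    rw [← hscale]
    infer_instance
  rw [hscale, ← Measure.pi_map_pi fun _ => by fun_prop]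
  rfl

end Law

namespace IsIIDGaussian

variable {Ω : Type*} [MeasurableSpace Ω] {P : Measure Ω} {X : ℕ → Ω → ℝ} {μ : ℝ} {v : ℝ≥0} {n : ℕ}

lemma sub_const (h : IsIIDGaussian P X μ v) : IsIIDGaussian P (fun i ω => X i ω - μ) 0 v where
  indep := h.indep.comp (fun _ t => t - μ) fun _ => by fun_prop
  law i := by
    have hshift : HasLaw (fun t : ℝ => t - μ) (gaussianReal 0 v) (gaussianReal μ v) :=
      ⟨by fun_prop, by rw [gaussianReal_map_sub_const, sub_self]⟩
    exact hshift.comp (h.law i)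

lemma ae_ne_zero (h : IsIIDGaussian P X μ v) (hv : v ≠ 0) (hn : 0 < n) :
    ∀ᵐ ω ∂P, (fun i : Fin n => X i ω) ≠ 0 := by
  have := nullSingletonClass_gaussianReal (μ := μ) hv
  have hX0 : ∀ᵐ t ∂P.map (X 0), t ≠ 0 := by
    rw [(h.law 0).map_eq]
    exact Measure.ae_ne _ 0
  filter_upwards [ae_of_ae_map (h.law 0).aemeasurable hX0] with ω hω hzero
  exact hω (congrFun hzero ⟨0, hn⟩)

lemma map_eq_pi (h : IsIIDGaussian P X μ v) (n : ℕ) :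
    P.map (fun ω (i : Fin n) => X i ω) = Measure.pi fun _ => gaussianReal μ v := by
  have hind : iIndepFun (fun i : Fin n => X i) P := h.indep.precomp Fin.val_injective
  rw [iIndepFun.map_fun_eq_pi_map (f := fun i : Fin n => X i) (fun i => (h.law i).aemeasurable)
    hind]
  simp_rw [(h.law _).map_eq]

lemma lintegral_comp_eq (h : IsIIDGaussian P X 0 v) (hv : v ≠ 0) {g : (Fin n → ℝ) → ℝ≥0∞}
    (hg : Measurable[coneSigma (Fin n → ℝ)] g) :
    ∫⁻ ω, g (fun i => X i ω) ∂P = ∫⁻ x, g x ∂gaussianPi n 0 := by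
  obtain ⟨hg_meas, hg_smul⟩ := measurable_coneSigma_iff.mp hg
  have hsqrt : 0 < √(v : ℝ) := by positivity
  have hX : AEMeasurable (fun ω (i : Fin n) => X i ω) P :=
    aemeasurable_pi_lambda _ fun i => (h.law i).aemeasurable
  rw [← lintegral_map' hg_meas.aemeasurable hX, h.map_eq_pi, pi_gaussianReal_zero_eq_map,
    lintegral_map hg_meas (by fun_prop)]
  simp_rw [hg_smul _ hsqrt]

lemma tENSM_eq_lintegral_tLR (h : IsIIDGaussian P X μ v) (hv : v ≠ 0) (hn : 0 < n) :
    ∀ᵐ ω ∂P, tENSM n (fun i => X i ω) = ∫⁻ θ : ℝ, tLR θ n (fun i => X i ω) := by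
  filter_upwards [h.ae_ne_zero hv hn] with ω hω
  have hrestrict (θ : ℝ) : tLR θ n (fun i => X i ω) = tLR θ n (zeroExtend fun i : Fin n => X i ω) :=
    (tLR_zeroExtend_restrict θ fun i => X i ω).symm
  simp_rw [hrestrict, lintegral_tLR_zeroExtend hω, tENSM_zeroExtend_restrict fun i => X i ω]

end IsIIDGaussian

section Filtration

variable {Ω : Type*} [MeasurableSpace Ω] {X : ℕ → Ω → ℝ} (hX : ∀ i, Measurable (X i))

lemma measurable_scaleInvFiltration_comp {β : Type*} [MeasurableSpace β] {n : ℕ}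
    {g : (Fin n → ℝ) → β} (hg : Measurable[coneSigma (Fin n → ℝ)] g) :
    Measurable[scaleInvFiltration X hX n] fun ω => g fun i => X i ω := by
  change Measurable[scaleInvSigma X n] _
  rw [scaleInvSigma_eq_comap]
  exact hg.comp (comap_measurable _)

lemma measurable_tLR (θ : ℝ) (n : ℕ) :
    Measurable[scaleInvFiltration X hX n] fun ω => tLR θ n fun i => X i ω := by
  convert measurable_scaleInvFiltration_comp hX (measurable_coneSigma_tLR (n := n) θ) using 2 with ω
  exact (tLR_zeroExtend_restrict θ fun i => X i ω).symm

lemma measurable_tENSM (n : ℕ) :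
    Measurable[scaleInvFiltration X hX n] fun ω => tENSM n fun i => X i ω := by
  convert measurable_scaleInvFiltration_comp hX (measurable_coneSigma_tENSM (n := n)) using 2 with ω
  exact (tENSM_zeroExtend_restrict fun i => X i ω).symm

include hX in
lemma measurable_tLR_uncurry (n : ℕ) :
    Measurable fun p : Ω × ℝ => tLR p.2 n fun i => X i p.1 := by
  simp only [tLR, pSum, pSumSq]
  fun_prop

end Filtration

namespace IsIIDGaussian

variable {Ω : Type*} [MeasurableSpace Ω] {P : Measure Ω} {X : ℕ → Ω → ℝ} {v : ℝ≥0} {n : ℕ}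
  (hX : ∀ i, Measurable (X i))
include hX

lemma setLIntegral_tLR (h : IsIIDGaussian P X 0 v) (hv : v ≠ 0) (θ : ℝ) (hn : 0 < n)
    {A : Set (Fin n → ℝ)} (hA : MeasurableSet[coneSigma (Fin n → ℝ)] A) :
    ∫⁻ ω in (fun ω (i : Fin n) => X i ω) ⁻¹' A, tLR θ n (fun i => X i ω) ∂P = gaussianPi n θ A := by
  have hXn : Measurable fun ω (i : Fin n) => X i ω := measurable_pi_lambda _ fun i => hX i
  rw [← setLIntegral_tLR_gaussianPi hn θ hA, ← lintegral_indicator hA.1,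
    ← h.lintegral_comp_eq hv ((measurable_coneSigma_tLR θ).indicator hA),
    ← lintegral_indicator (hXn hA.1)]
  refine lintegral_congr fun ω => ?_
  simp only [Set.indicator, tLR_zeroExtend_restrict θ fun i => X i ω]
  rfl

lemma setLIntegral_tLR_succ (h : IsIIDGaussian P X 0 v) (hv : v ≠ 0) (θ : ℝ) (hn : 0 < n)
    {s : Set Ω} (hs : MeasurableSet[scaleInvFiltration X hX n] s) :
    ∫⁻ ω in s, tLR θ n (fun i => X i ω) ∂P = ∫⁻ ω in s, tLR θ (n + 1) (fun i => X i ω) ∂P := by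
  change MeasurableSet[scaleInvSigma X n] s at hs
  rw [scaleInvSigma_eq_comap] at hs
  obtain ⟨A, hA, rfl⟩ := hs
  have hdrop : Measurable fun (x : Fin (n + 1) → ℝ) (i : Fin n) => x i.castSucc := by fun_prop
  rw [h.setLIntegral_tLR hX hv θ hn hA, ← gaussianPi_map_castSucc, Measure.map_apply hdrop hA.1,
    ← h.setLIntegral_tLR hX hv θ n.succ_pos ⟨hdrop hA.1, fun c hc x => hA.2 c hc _⟩]
  rfl

lemma isNM_tLR [IsProbabilityMeasure P] (h : IsIIDGaussian P X 0 v) (hv : v ≠ 0) (θ : ℝ) :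
    IsNM P (scaleInvFiltration X hX) 1 fun n ω => tLR θ n fun i => X i ω where
  integrable := by
    have hmass := h.setLIntegral_tLR hX hv θ one_pos MeasurableSet.univ
    rw [Set.preimage_univ, setLIntegral_univ, measure_univ] at hmass
    simp only [hmass, ENNReal.one_lt_top]
  adapted n _ := measurable_tLR hX θ n
  condExp_eq n hn := (ae_eq_condLExp ((scaleInvFiltration X hX).le n) P _ (measurable_tLR hX θ n)
    fun _ hs => h.setLIntegral_tLR_succ hX hv θ hn hs).symm

lemma setLIntegral_tENSM [SFinite P] (h : IsIIDGaussian P X 0 v) (hv : v ≠ 0) (hn : 0 < n)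
    (s : Set Ω) :
    ∫⁻ ω in s, tENSM n (fun i => X i ω) ∂P = ∫⁻ θ : ℝ, ∫⁻ ω in s, tLR θ n (fun i => X i ω) ∂P := by
  rw [lintegral_congr_ae (ae_restrict_of_ae (h.tENSM_eq_lintegral_tLR hv hn)),
    lintegral_lintegral_swap (measurable_tLR_uncurry hX n).aemeasurable]

theorem isENSM_tENSM [IsProbabilityMeasure P] (h : IsIIDGaussian P X 0 v) (hv : v ≠ 0) :
    IsENSM P (scaleInvFiltration X hX) 1 fun n ω => tENSM n fun i => X i ω where
  adapted n _ := measurable_tENSM hX n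
  condExp_le n hn := by
    refine (ae_eq_condLExp ((scaleInvFiltration X hX).le n) P _ (measurable_tENSM hX n)
      fun s hs => ?_).symm.le
    rw [h.setLIntegral_tENSM hX hv hn, h.setLIntegral_tENSM hX hv n.succ_pos]
    simp_rw [h.setLIntegral_tLR_succ hX hv _ hn hs]

end IsIIDGaussian

section Chi

lemma lintegral_gammaMeasure (a r : ℝ) (f : ℝ → ℝ≥0∞) :
    ∫⁻ s, f s ∂gammaMeasure a r =
      ∫⁻ s, ENNReal.ofReal (r ^ a / Real.Gamma a * (s ^ a * Real.exp (-(r * s)))) * f s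
        ∂posHaar := by
  have hpdf : Measurable (gammaPDF a r) := (measurable_gammaPDFReal a r).ennreal_ofReal
  rw [gammaMeasure, lintegral_withDensity_eq_lintegral_mul_non_measurable _ hpdf
    (ae_of_all _ fun _ => ENNReal.ofReal_lt_top), lintegral_posHaar,
    ← lintegral_indicator measurableSet_Ioi]
  refine lintegral_congr_ae ?_
  filter_upwards [Measure.ae_ne volume 0] with s hs
  rcases hs.lt_or_gt with hs | hs
  · rw [Set.indicator_of_notMem (by simpa using hs.le), Pi.mul_apply, gammaPDF_of_neg hs, zero_mul]
  · rw [Set.indicator_of_mem (by simpa using hs), Pi.mul_apply, gammaPDF_of_nonneg hs.le,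
      ← mul_assoc, ← ENNReal.ofReal_mul (by positivity), Real.rpow_sub_one hs.ne']
    congr 2
    ring

variable {n : ℕ}

lemma rayIntegral_comp_pSumSq_mul_gaussianPiPDF (f : ℝ → ℝ≥0∞) {x : Fin n → ℝ} (hx : x ≠ 0) :
    rayIntegral (fun x => f (pSumSq n (zeroExtend x)) * gaussianPiPDF 0 x) x =
      (∫⁻ s, f s ∂gammaMeasure (n / 2) (1 / 2)) * rayIntegral (gaussianPiPDF 0) x := by
  have hn := pos_of_pi_ne_zero hx
  have hV := pSumSq_zeroExtend_pos hx
  rw [rayIntegral_gaussianPiPDF_zero hx, lintegral_gammaMeasure,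
    ENNReal.ofReal_rpow_of_pos (by positivity), ← lintegral_posHaar_comp_mul_rpow hV two_ne_zero,
    mul_comm, ← mul_assoc, ← lintegral_const_mul' _ _ (by finiteness)]
  refine lintegral_posHaar_congr fun t ht => ?_
  simp only [gaussianPiPDF_eq, pSumSq_zeroExtend_smul, Module.finrank_fin_fun, Real.rpow_two]
  generalize pSumSq n (zeroExtend x) = V at hV
  have hconst : t ^ n * Real.exp (-(t ^ 2 * V / 2)) = Real.Gamma (n / 2) / 2 *
      (V / 2) ^ (-((n : ℝ) / 2)) * |2| * ((1 / 2) ^ ((n : ℝ) / 2) / Real.Gamma (n / 2) *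
        ((V * t ^ 2) ^ ((n : ℝ) / 2) * Real.exp (-(1 / 2 * (V * t ^ 2))))) := by
    have ht2 : (t ^ 2) ^ ((n : ℝ) / 2) = t ^ n := by
      rw [← Real.rpow_natCast_mul ht.le, Nat.cast_ofNat, mul_div_cancel₀ _ two_ne_zero,
        Real.rpow_natCast]
    rw [Real.mul_rpow hV.le (by positivity), ht2, div_eq_mul_one_div V 2,
      Real.mul_rpow hV.le (by norm_num), Real.rpow_neg hV.le, Real.rpow_neg (by norm_num), abs_two]
    field_simp
  simp only [zero_mul, zero_sub, sub_self, ne_eq, OfNat.ofNat_ne_zero, not_false_eq_true, zero_pow,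
    mul_zero, zero_div]
  rw [mul_comm V] at hconst ⊢
  have hconst' := congrArg ENNReal.ofReal hconst
  rw [ENNReal.ofReal_mul (by positivity), ENNReal.ofReal_mul (by positivity),
    ENNReal.ofReal_mul (by positivity), ENNReal.ofReal_mul (by positivity)] at hconst'
  calc _ = ENNReal.ofReal ((√(2 * Real.pi))⁻¹ ^ n) * (ENNReal.ofReal (t ^ n) *
        ENNReal.ofReal (Real.exp (-(t ^ 2 * V / 2)))) * f (t ^ 2 * V) := by ring
    _ = _ := by rw [hconst']; ring

lemma map_pSumSq_gaussianPi (hn : 0 < n) :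
    (gaussianPi n 0).map (fun x => pSumSq n (zeroExtend x)) = gammaMeasure (n / 2) (1 / 2) := by
  have : NeZero n := ⟨hn.ne'⟩
  have hne : ∀ᵐ x : Fin n → ℝ, x ≠ 0 := Measure.ae_ne volume 0
  have hV : Measurable fun x : Fin n → ℝ => pSumSq n (zeroExtend x) := measurable_pSumSq_zeroExtend
  refine Measure.ext_of_lintegral _ fun f hf => ?_
  have hratio := setLIntegral_rayIntegral_div_rayIntegral (μ := (volume : Measure (Fin n → ℝ)))
    (p := gaussianPiPDF 0) (q := fun x => f (pSumSq n (zeroExtend x)) * gaussianPiPDF 0 x)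
    (by fun_prop) (by fun_prop)
    (hne.mono fun x hx => rayIntegral_gaussianPiPDF_zero_ne_zero hx)
    (hne.mono fun x hx => rayIntegral_gaussianPiPDF_zero_ne_top hx) MeasurableSet.univ
  rw [← gaussianPi_eq_withDensity] at hratio
  calc ∫⁻ v, f v ∂(gaussianPi n 0).map (fun x => pSumSq n (zeroExtend x))
      = volume.withDensity (fun x : Fin n → ℝ =>
          f (pSumSq n (zeroExtend x)) * gaussianPiPDF 0 x) Set.univ := by
        rw [lintegral_map hf hV, gaussianPi_eq_withDensity,
          lintegral_withDensity_eq_lintegral_mul _ (by fun_prop) (by fun_prop),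
          withDensity_apply _ MeasurableSet.univ, setLIntegral_univ]
        simp_rw [Pi.mul_apply, mul_comm]
    _ = ∫⁻ _, ∫⁻ s, f s ∂gammaMeasure (n / 2) (1 / 2) ∂gaussianPi n 0 := by
        rw [← hratio, setLIntegral_univ]
        refine lintegral_congr_ae ?_
        filter_upwards [ae_ne_zero_gaussianPi hn 0] with x hx
        rw [rayIntegral_comp_pSumSq_mul_gaussianPiPDF f hx, ENNReal.mul_div_cancel_right
          (rayIntegral_gaussianPiPDF_zero_ne_zero hx) (rayIntegral_gaussianPiPDF_zero_ne_top hx)]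
    _ = ∫⁻ s, f s ∂gammaMeasure (n / 2) (1 / 2) := by rw [lintegral_const, measure_univ, mul_one]

end Chi

section Cochran

lemma map_inner_norm_sq_sub_stdGaussian {E : Type*} [NormedAddCommGroup E] [InnerProductSpace ℝ E]
    [FiniteDimensional ℝ E] [MeasurableSpace E] [BorelSpace E] {k : ℕ}
    (hk : Module.finrank ℝ E = k + 1) {u : E} (hu : ‖u‖ = 1) :
    (stdGaussian E).map (fun z => (inner ℝ u z, ‖z‖ ^ 2 - inner ℝ u z ^ 2)) =
      (gaussianReal 0 1).prod ((gaussianPi k 0).map fun y => pSumSq k (zeroExtend y)) := by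
  have hon : Orthonormal ℝ (({0} : Set (Fin (k + 1))).domRestrict fun _ => u) :=
    ⟨fun _ => hu, fun i j hij => absurd (Subsingleton.elim i j) hij⟩
  obtain ⟨b, hb⟩ := hon.exists_orthonormalBasis_extension_of_card_eq (by simpa using hk)
  have hinner (x : Fin (k + 1) → ℝ) (j : Fin (k + 1)) : inner ℝ (b j) (∑ i, x i • b i) = x j := by
    simp [inner_sum, inner_smul_right, b.inner_eq_ite]
  have hnorm (x : Fin (k + 1) → ℝ) : ‖∑ i, x i • b i‖ ^ 2 = ∑ i, x i ^ 2 := by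
    simp_rw [← b.sum_sq_norm_inner_right, hinner, Real.norm_eq_abs, sq_abs]
  have hsplit (x : Fin (k + 1) → ℝ) : (inner ℝ u (∑ i, x i • b i),
      ‖∑ i, x i • b i‖ ^ 2 - inner ℝ u (∑ i, x i • b i) ^ 2) =
      (x 0, pSumSq k (zeroExtend fun i => x i.succ)) := by
    rw [← hb 0 rfl, hinner, hnorm, pSumSq_zeroExtend, Fin.sum_univ_succ, add_sub_cancel_left]
  have hsplitPi := (measurePreserving_piFinSuccAbove (fun _ : Fin (k + 1) => gaussianReal 0 1)
    0).map_eq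
  have hsumSq : Measurable fun y : Fin k → ℝ => pSumSq k (zeroExtend y) :=
    measurable_pSumSq_zeroExtend
  have hprod := Measure.map_prod_map (gaussianReal 0 1) (gaussianPi k 0) measurable_id hsumSq
  rw [Measure.map_id] at hprod
  rw [hprod, gaussianPi, ← hsplitPi, Measure.map_map (by fun_prop) (by fun_prop),
    stdGaussian_eq_map_pi_orthonormalBasis b, Measure.map_map (by fun_prop) (by fun_prop)]
  congr 1
  ext1 x
  exact hsplit x

lemma map_avg_sampleVar_gaussianPi {k : ℕ} (hk : 0 < k) :
    (gaussianPi (k + 1) 0).map (fun x => (√(k + 1) * avg (k + 1) (zeroExtend x),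
        (k + 1) * sampleVar (k + 1) (zeroExtend x))) =
      (gaussianReal 0 1).prod (gammaMeasure (k / 2) (1 / 2)) := by
  let u : EuclideanSpace ℝ (Fin (k + 1)) := WithLp.toLp 2 fun _ => (√(k + 1))⁻¹
  have hk1 : (0 : ℝ) < k + 1 := by positivity
  have hu : ‖u‖ = 1 := by
    rw [← sq_eq_sq₀ (norm_nonneg _) zero_le_one, EuclideanSpace.real_norm_sq_eq]
    simp [u, Real.sq_sqrt hk1.le, hk1.ne']
  rw [← map_pSumSq_gaussianPi hk, ← map_inner_norm_sq_sub_stdGaussian (by simp) hu,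
    ← map_pi_eq_stdGaussian, Measure.map_map (by fun_prop) (by fun_prop)]
  congr 1
  ext1 x
  have hinner : inner ℝ u (WithLp.toLp 2 x) = √(k + 1) * avg (k + 1) (zeroExtend x) := by
    rw [PiLp.inner_apply, avg, pSum_zeroExtend, Nat.cast_add_one]
    simp only [u, RCLike.inner_apply, conj_trivial, ← Finset.sum_mul]
    field_simp
    rw [Real.sq_sqrt hk1.le]
  have hnorm : ‖(WithLp.toLp 2 x : EuclideanSpace ℝ (Fin (k + 1)))‖ ^ 2 =
      pSumSq (k + 1) (zeroExtend x) := by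
    rw [EuclideanSpace.real_norm_sq_eq, pSumSq_zeroExtend]
  have hvar := sampleVar_add_sq_avg (k + 1) (zeroExtend x)
  rw [Nat.cast_add_one, eq_div_iff hk1.ne'] at hvar
  rw [Function.comp_apply, hinner, hnorm, mul_pow, Real.sq_sqrt hk1.le, ← hvar]
  congr 1
  ring

end Cochran

section Student

variable {k : ℝ}

/-- Student's t-distribution with `k` degrees of freedom, a probability measure for `0 < k`. -/
noncomputable def studentReal (k : ℝ) : Measure ℝ :=
  volume.withDensity fun t => ENNReal.ofReal (tPDF k t)

@[fun_prop]
lemma measurable_tPDF (k : ℝ) : Measurable (tPDF k) := by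
  unfold tPDF
  fun_prop

lemma tPDF_eq_half_rpow (hk : 0 < k) (t : ℝ) :
    tPDF k t = (1 / 2) ^ (k / 2) / Real.Gamma (k / 2) * (√(2 * Real.pi * k))⁻¹ *
      (Real.Gamma ((k + 1) / 2) * ((1 + t ^ 2 / k) / 2) ^ (-((k + 1) / 2))) := by
  have hhalf : (1 / 2 : ℝ) ^ (k / 2) * (1 / 2) ^ (-((k + 1) / 2)) = √2 := by
    rw [← Real.rpow_add (by norm_num), Real.sqrt_eq_rpow, one_div, Real.inv_rpow zero_le_two,
      ← Real.rpow_neg zero_le_two]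
    ring_nf
  have hsqrt : √(2 * Real.pi * k) = √2 * √(k * Real.pi) := by
    rw [← Real.sqrt_mul zero_le_two]
    ring_nf
  rw [tPDF, hsqrt, div_eq_mul_one_div (1 + t ^ 2 / k), Real.mul_rpow (by positivity) (by norm_num)]
  field_simp
  rw [← hhalf]

lemma lintegral_gaussianPDF_gammaMeasure (hk : 0 < k) (t : ℝ) :
    ∫⁻ w, gaussianPDF 0 (k / w).toNNReal t ∂gammaMeasure (k / 2) (1 / 2) =
      ENNReal.ofReal (tPDF k t) := by
  have hs : 0 < (k + 1) / 2 := by positivity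
  have hr : 0 ≤ (1 + t ^ 2 / k) / 2 := by positivity
  have hgamma := lintegral_posHaar_rpow_mul_exp_neg hs one_pos hr
  rw [div_one, div_one, ENNReal.ofReal_rpow_of_pos (by positivity),
    ← ENNReal.ofReal_mul (by positivity)] at hgamma
  rw [lintegral_gammaMeasure, tPDF_eq_half_rpow hk, ENNReal.ofReal_mul (by positivity), ← hgamma,
    ← lintegral_const_mul' _ _ ENNReal.ofReal_ne_top]
  refine lintegral_posHaar_congr fun w hw => ?_
  have hpow : w ^ ((k + 1) / 2) = w ^ (k / 2) * √w := by
    rw [Real.sqrt_eq_rpow, ← Real.rpow_add hw, add_div]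
  have hexp : Real.exp (-((1 + t ^ 2 / k) / 2 * w)) =
      Real.exp (-(1 / 2 * w)) * Real.exp (-(t - 0) ^ 2 / (2 * (k / w))) := by
    rw [← Real.exp_add]
    congr 1
    field_simp
    ring
  rw [gaussianPDF, gaussianPDFReal, Real.coe_toNNReal _ (by positivity),
    ← ENNReal.ofReal_mul (by positivity), ← ENNReal.ofReal_mul (by positivity), Real.rpow_one,
    hpow, hexp, mul_div_assoc', Real.sqrt_div' _ hw.le]
  congr 1
  field_simp

lemma map_div_sqrt_gaussianReal_prod_gammaMeasure (hk : 0 < k) :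
    ((gaussianReal 0 1).prod (gammaMeasure (k / 2) (1 / 2))).map (fun p => p.1 / √(p.2 / k)) =
      studentReal k := by
  refine Measure.ext_of_lintegral _ fun f hf => ?_
  have : IsProbabilityMeasure (gammaMeasure (k / 2) (1 / 2)) :=
    isProbabilityMeasure_gammaMeasure (by positivity) (by norm_num)
  have hcond {w : ℝ} (hw : 0 < w) : (gaussianReal 0 1).map (· / √(w / k)) =
      volume.withDensity (gaussianPDF 0 (k / w).toNNReal) := by
    have hvar : (k / w).toNNReal ≠ 0 := (Real.toNNReal_pos.mpr (by positivity)).ne'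
    rw [gaussianReal_map_div_const, ← gaussianReal_of_var_ne_zero _ hvar, zero_div]
    congr 1
    ext
    rw [NNReal.coe_div, NNReal.coe_mk, NNReal.coe_one, Real.sq_sqrt (by positivity),
      Real.coe_toNNReal _ (by positivity), one_div_div]
  calc _ = ∫⁻ w, ∫⁻ z, f (z / √(w / k)) ∂gaussianReal 0 1 ∂gammaMeasure (k / 2) (1 / 2) := by
        rw [lintegral_map hf (by fun_prop), lintegral_prod_symm' _ (by fun_prop)]
    _ = ∫⁻ w, ∫⁻ t, gaussianPDF 0 (k / w).toNNReal t * f t ∂volume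
        ∂gammaMeasure (k / 2) (1 / 2) := by
        simp_rw [lintegral_gammaMeasure]
        refine lintegral_posHaar_congr fun w hw => ?_
        rw [← lintegral_map hf (by fun_prop), hcond hw,
          lintegral_withDensity_eq_lintegral_mul _ (measurable_gaussianPDF _ _) hf]
        rfl
    _ = ∫⁻ t, ENNReal.ofReal (tPDF k t) * f t := by
        rw [lintegral_lintegral_swap (by fun_prop)]
        refine lintegral_congr fun t => ?_
        rw [lintegral_mul_const _ (by fun_prop), lintegral_gaussianPDF_gammaMeasure hk]
    _ = ∫⁻ t, f t ∂studentReal k := by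
        rw [studentReal, lintegral_withDensity_eq_lintegral_mul _ (by fun_prop) hf]
        rfl

lemma isProbabilityMeasure_studentReal (hk : 0 < k) : IsProbabilityMeasure (studentReal k) := by
  have : IsProbabilityMeasure (gammaMeasure (k / 2) (1 / 2)) :=
    isProbabilityMeasure_gammaMeasure (by positivity) (by norm_num)
  rw [← map_div_sqrt_gaussianReal_prod_gammaMeasure hk]
  exact Measure.isProbabilityMeasure_map (by fun_prop)

end Student

section TStat

variable {n : ℕ} {x : ℕ → ℝ}

/-- Student's t-statistic `√(n - 1) X̄ₙ / sₙ`. The factor is `√(n - 1)` rather than `√n` because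
`sₙ` does not carry Bessel's correction. -/
noncomputable def tStat (n : ℕ) (x : ℕ → ℝ) : ℝ := √(n - 1) * avg n x / √(sampleVar n x)

lemma ae_pos_gammaMeasure (a r : ℝ) : ∀ᵐ s ∂gammaMeasure a r, 0 < s := by
  have hnull : ∫⁻ s, (Set.Iic 0).indicator 1 s ∂gammaMeasure a r = 0 := by
    rw [lintegral_gammaMeasure, ← lintegral_zero (μ := posHaar)]
    refine lintegral_posHaar_congr fun s hs => ?_
    rw [Set.indicator_of_notMem (by simpa using hs), mul_zero]
  rw [lintegral_indicator_one measurableSet_Iic] at hnull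
  filter_upwards [measure_eq_zero_iff_ae_notMem.mp hnull] with s hs using not_le.mp hs

lemma measurable_avg_zeroExtend : Measurable fun x : Fin n → ℝ => avg n (zeroExtend x) :=
  measurable_pSum_zeroExtend.div_const _

lemma measurable_sampleVar_zeroExtend :
    Measurable fun x : Fin n → ℝ => sampleVar n (zeroExtend x) := by
  simp_rw [eq_sub_of_add_eq (sampleVar_add_sq_avg n _)]
  exact (measurable_pSumSq_zeroExtend.div_const _).sub (measurable_avg_zeroExtend.pow_const 2)

lemma ae_sampleVar_pos_gaussianPi (hn : 2 ≤ n) :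
    ∀ᵐ x ∂gaussianPi n 0, 0 < sampleVar n (zeroExtend x) := by
  obtain ⟨k, rfl⟩ : ∃ k, n = k + 1 := ⟨n - 1, by lia⟩
  have havg := measurable_avg_zeroExtend (n := k + 1)
  have hvar := measurable_sampleVar_zeroExtend (n := k + 1)
  have hsnd : ∀ᵐ p ∂(gaussianReal 0 1).prod (gammaMeasure (k / 2) (1 / 2)), 0 < p.2 :=
    Measure.quasiMeasurePreserving_snd.ae (ae_pos_gammaMeasure _ _)
  rw [← map_avg_sampleVar_gaussianPi (by lia)] at hsnd
  filter_upwards [ae_of_ae_map (by fun_prop) hsnd] with x hx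
  exact pos_of_mul_pos_right hx (by positivity)

lemma map_tStat_gaussianPi (hn : 2 ≤ n) :
    (gaussianPi n 0).map (fun x => tStat n (zeroExtend x)) = studentReal (n - 1) := by
  obtain ⟨k, rfl⟩ : ∃ k, n = k + 1 := ⟨n - 1, by lia⟩
  have hk : 0 < k := by lia
  have havg := measurable_avg_zeroExtend (n := k + 1)
  have hvar := measurable_sampleVar_zeroExtend (n := k + 1)
  rw [Nat.cast_add_one, add_sub_cancel_right,
    ← map_div_sqrt_gaussianReal_prod_gammaMeasure (Nat.cast_pos.mpr hk),
    ← map_avg_sampleVar_gaussianPi hk, Measure.map_map (by fun_prop) (by fun_prop)]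
  congr 1
  ext1 x
  rw [Function.comp_apply, tStat, Nat.cast_add_one, add_sub_cancel_right,
    Real.sqrt_div' _ k.cast_nonneg, Real.sqrt_mul (by positivity)]
  field_simp

lemma tENSM_eq_ofReal_sqrt (hn : 0 < n) (hx : 0 < sampleVar n x) :
    tENSM n x =
      ENNReal.ofReal √(2 * Real.pi * (1 / n * (1 + avg n x ^ 2 / sampleVar n x) ^ n)) := by
  have hV : n = 1 → pSumSq n x ≠ 0 := fun _ hV => by
    have hvar := sampleVar_add_sq_avg n x
    rw [hV, zero_div] at hvar
    nlinarith [sq_nonneg (avg n x)]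
  have hratio : (sampleVar n x + avg n x ^ 2) / sampleVar n x =
      1 + avg n x ^ 2 / sampleVar n x := by
    field_simp
  rw [tENSM_eq_sampleVar hn hV, ← ENNReal.ofReal_div_of_pos hx, hratio,
    ENNReal.ofReal_rpow_of_pos (by positivity), ← ENNReal.ofReal_mul (by positivity),
    ← mul_assoc, mul_one_div, Real.sqrt_mul (by positivity), Real.sqrt_eq_rpow (_ ^ n),
    ← Real.rpow_natCast_mul (by positivity), mul_one_div]

lemma tENSM_eq_ofReal_sqrt_laiB_tStat (hn : 2 ≤ n) (hx : 0 < sampleVar n x) :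
    tENSM n x = ENNReal.ofReal √(2 * Real.pi * laiB n (tStat n x)) := by
  have hn1 : (0 : ℝ) < n - 1 := sub_pos.mpr (Nat.one_lt_cast.mpr hn)
  rw [tENSM_eq_ofReal_sqrt (by lia) hx, laiB, tStat, div_pow, mul_pow, Real.sq_sqrt hn1.le,
    Real.sq_sqrt hx.le]
  field_simp

end TStat

section LaiB

variable {m n : ℕ}

lemma laiB_pos (hm : 2 ≤ m) (a : ℝ) : 0 < laiB m a := by
  have hm1 : (0 : ℝ) < m - 1 := sub_pos.mpr (Nat.one_lt_cast.mpr hm)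
  rw [laiB]
  positivity

lemma one_le_laiB_mul (hm : 2 ≤ m) (hmn : m ≤ n) (a : ℝ) : 1 ≤ laiB m a * n := by
  have hm1 : (0 : ℝ) < m - 1 := sub_pos.mpr (Nat.one_lt_cast.mpr hm)
  calc (1 : ℝ) ≤ (1 + a ^ 2 / ((m : ℝ) - 1)) ^ m :=
        one_le_pow₀ (le_add_of_nonneg_right (by positivity))
    _ = laiB m a * m := by
        rw [laiB]
        field_simp
    _ ≤ laiB m a * n := by
        have := laiB_pos hm a
        gcongr

lemma avg_sub_const (hn : 0 < n) (x : ℕ → ℝ) (μ : ℝ) :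
    avg n (fun i => x i - μ) = avg n x - μ := by
  simp [avg, pSum, sub_div, mul_div_cancel_left₀, hn.ne']

lemma sampleVar_sub_const (n : ℕ) (x : ℕ → ℝ) (μ : ℝ) :
    sampleVar n (fun i => x i - μ) = sampleVar n x := by
  rcases n.eq_zero_or_pos with rfl | hn
  · simp [sampleVar]
  simp only [sampleVar, avg_sub_const hn, sub_sub_sub_cancel_right]

lemma notMem_laiCI_iff_sampleVar_mul_lt (hm : 2 ≤ m) (hmn : m ≤ n) (a μ : ℝ) (x : ℕ → ℝ) :
    μ ∉ laiCI m a n x ↔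
      sampleVar n x * ((laiB m a * n) ^ (1 / (n : ℝ)) - 1) < (avg n x - μ) ^ 2 := by
  have hβ : 1 ≤ (laiB m a * n) ^ (1 / (n : ℝ)) :=
    Real.one_le_rpow (one_le_laiB_mul hm hmn a) (by positivity)
  have hradius : 0 ≤ sampleVar n x * ((laiB m a * n) ^ (1 / (n : ℝ)) - 1) :=
    mul_nonneg (sampleVar_nonneg n x) (sub_nonneg.mpr hβ)
  rw [laiCI, ← Real.closedBall_eq_Icc, Metric.mem_closedBall, not_le, dist_comm, Real.dist_eq,
    laiRadius, Real.sqrt_lt hradius (abs_nonneg _), sq_abs]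

lemma sampleVar_mul_lt_iff_lt_tENSM {b : ℝ} (hb : 0 < b) (hn : 2 ≤ n) (x : ℕ → ℝ) :
    sampleVar n x * ((b * n) ^ (1 / (n : ℝ)) - 1) < avg n x ^ 2 ↔
      ENNReal.ofReal √(2 * Real.pi * b) < tENSM n x := by
  have hn0 : (0 : ℝ) < n := by positivity
  rcases (sampleVar_nonneg n x).eq_or_lt with hvar | hvar
  · rw [tENSM_eq_sampleVar (by lia) (by lia), ← hvar, zero_mul, zero_add, ENNReal.ofReal_zero]
    rcases eq_or_ne (avg n x) 0 with havg | havg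
    · simp [havg, hn0]
    · rw [ENNReal.div_zero (ENNReal.ofReal_pos.mpr (by positivity)).ne',
        ENNReal.top_rpow_of_pos (by positivity),
        ENNReal.mul_top (ENNReal.ofReal_pos.mpr (by positivity)).ne']
      exact iff_of_true (by positivity) ENNReal.ofReal_lt_top
  · set β := (b * n) ^ (1 / (n : ℝ)) with hβ
    have hβ0 : 0 ≤ β := by positivity
    have hβn : β ^ n = b * n := by
      rw [hβ, one_div, Real.rpow_inv_natCast_pow (by positivity) (by lia)]
    have hratio : 0 ≤ 1 + avg n x ^ 2 / sampleVar n x := by positivity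
    calc sampleVar n x * (β - 1) < avg n x ^ 2
        ↔ β < 1 + avg n x ^ 2 / sampleVar n x := by
          rw [← sub_lt_iff_lt_add', lt_div_iff₀' hvar]
      _ ↔ b < 1 / n * (1 + avg n x ^ 2 / sampleVar n x) ^ n := by
          rw [← pow_lt_pow_iff_left₀ hβ0 hratio (by lia : n ≠ 0), hβn, one_div_mul_eq_div,
            lt_div_iff₀ hn0]
      _ ↔ ENNReal.ofReal √(2 * Real.pi * b) < tENSM n x := by
          rw [tENSM_eq_ofReal_sqrt (by lia) hvar, ENNReal.ofReal_lt_ofReal_iff (by positivity),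
            Real.sqrt_lt_sqrt_iff (by positivity), mul_lt_mul_iff_right₀ (by positivity)]

theorem notMem_laiCI_iff (hm : 2 ≤ m) (hmn : m ≤ n) (a μ : ℝ) (x : ℕ → ℝ) :
    μ ∉ laiCI m a n x ↔
      ENNReal.ofReal √(2 * Real.pi * laiB m a) < tENSM n (fun i => x i - μ) := by
  rw [notMem_laiCI_iff_sampleVar_mul_lt hm hmn,
    ← sampleVar_mul_lt_iff_lt_tENSM (laiB_pos hm a) (hm.trans hmn), sampleVar_sub_const,
    avg_sub_const (by lia)]

end LaiB

section VilleBound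

variable {Ω : Type*} [MeasurableSpace Ω] {P : Measure Ω} {M : ℕ → Ω → ℝ≥0∞} {m : ℕ} {ε : ℝ≥0∞}

lemma villeBound_eq_lintegral_min (hM : Measurable (M m)) (h0 : ε ≠ 0) (htop : ε ≠ ∞) :
    villeBound P M m ε = ∫⁻ ω, min (ε⁻¹ * M m ω) 1 ∂P := by
  have hs : MeasurableSet {ω | M m ω < ε} := hM measurableSet_Iio
  have hcompl : {ω | ε ≤ M m ω} = {ω | M m ω < ε}ᶜ := by
    ext ω
    simp
  have hmul_le {ω : Ω} : ε⁻¹ * M m ω ≤ 1 ↔ M m ω ≤ ε := by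
    rw [mul_comm, ← div_eq_mul_inv, ENNReal.div_le_iff h0 htop, one_mul]
  have hle_mul {ω : Ω} : 1 ≤ ε⁻¹ * M m ω ↔ ε ≤ M m ω := by
    rw [mul_comm, ← div_eq_mul_inv, ENNReal.le_div_iff_mul_le (.inl h0) (.inl htop), one_mul]
  rw [villeBound, hcompl, ← lintegral_const_mul _ hM,
    ← lintegral_add_compl (fun ω => min (ε⁻¹ * M m ω) 1) hs, ← setLIntegral_one]
  congr 1
  · exact setLIntegral_congr_fun hs fun ω hω => (min_eq_left (hmul_le.mpr (le_of_lt hω))).symm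
  · exact setLIntegral_congr_fun hs.compl fun ω hω =>
      (min_eq_right (hle_mul.mpr (not_lt.mp hω))).symm

end VilleBound

section StudentTail

lemma integral_min_of_even_of_antitoneOn {f : ℝ → ℝ} {a : ℝ} (hf : Integrable f)
    (heven : f.Even) (hanti : AntitoneOn f (Set.Ici 0)) (ha : 0 ≤ a) :
    ∫ t, min (f t) (f a) = 2 * (a * f a + ∫ t in Set.Ioi a, f t) := by
  have habs (t : ℝ) : f |t| = f t := by
    rcases abs_choice t with ht | ht <;> simp only [ht, heven t]
  have hleft : Set.EqOn (fun t => min (f t) (f a)) (fun _ => f a) (Set.Ioc 0 a) := fun t ht =>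
    min_eq_right (hanti ht.1.le ha ht.2)
  have hright : Set.EqOn (fun t => min (f t) (f a)) f (Set.Ioi a) := fun t ht =>
    min_eq_left (hanti ha (ha.trans (le_of_lt ht)) (le_of_lt ht))
  calc ∫ t, min (f t) (f a) = ∫ t, min (f |t|) (f a) := by simp_rw [habs]
    _ = 2 * ∫ t in Set.Ioi 0, min (f t) (f a) := integral_comp_abs (f := fun t => min (f t) (f a))
    _ = 2 * ((∫ t in Set.Ioc 0 a, min (f t) (f a)) + ∫ t in Set.Ioi a, min (f t) (f a)) := by
        rw [← Set.Ioc_union_Ioi_eq_Ioi ha, setIntegral_union (Set.Ioc_disjoint_Ioi le_rfl)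
          measurableSet_Ioi ((integrableOn_congr_fun hleft measurableSet_Ioc).mpr (by simp))
          ((integrableOn_congr_fun hright measurableSet_Ioi).mpr hf.integrableOn)]
    _ = 2 * (a * f a + ∫ t in Set.Ioi a, f t) := by
        rw [setIntegral_congr_fun measurableSet_Ioc hleft,
          setIntegral_congr_fun measurableSet_Ioi hright]
        simp [ha]

variable {k a : ℝ}

lemma tPDF_pos (hk : 0 < k) (t : ℝ) : 0 < tPDF k t := by
  rw [tPDF]
  positivity

lemma tPDF_even (k : ℝ) : (tPDF k).Even := fun t => by
  rw [tPDF, neg_sq, tPDF]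

lemma antitoneOn_tPDF (hk : 0 < k) : AntitoneOn (tPDF k) (Set.Ici 0) := by
  intro s hs t _ hst
  rw [Set.mem_Ici] at hs
  rw [tPDF, tPDF]
  refine mul_le_mul_of_nonneg_left (Real.rpow_le_rpow_of_nonpos (by positivity) ?_ ?_)
    (by positivity)
  · gcongr
  · linarith

lemma lintegral_tPDF (hk : 0 < k) : ∫⁻ t, ENNReal.ofReal (tPDF k t) = 1 := by
  have := isProbabilityMeasure_studentReal hk
  rw [← setLIntegral_univ, ← withDensity_apply _ .univ]
  exact measure_univ (μ := studentReal k)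

lemma integrable_tPDF (hk : 0 < k) : Integrable (tPDF k) := by
  refine ⟨by fun_prop, ?_⟩
  rw [hasFiniteIntegral_iff_ofReal (.of_forall fun t => (tPDF_pos hk t).le), lintegral_tPDF hk]
  exact ENNReal.one_lt_top

lemma integral_Ioi_tPDF (hk : 0 < k) (a : ℝ) : ∫ t in Set.Ioi a, tPDF k t = 1 - tCDF k a := by
  have hint := integrable_tPDF hk
  have htotal : ∫ t, tPDF k t = 1 := by
    rw [integral_eq_lintegral_of_nonneg_ae (.of_forall fun t => (tPDF_pos hk t).le)
      hint.aestronglyMeasurable, lintegral_tPDF hk, ENNReal.toReal_one]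
  rw [tCDF, ← htotal, ← intervalIntegral.integral_Iic_add_Ioi hint.integrableOn hint.integrableOn,
    add_sub_cancel_left]

lemma integral_min_tPDF (hk : 0 < k) (ha : 0 ≤ a) :
    ∫ t, min (tPDF k t) (tPDF k a) = 2 * (1 - tCDF k a + a * tPDF k a) := by
  rw [integral_min_of_even_of_antitoneOn (integrable_tPDF hk) (tPDF_even k) (antitoneOn_tPDF hk) ha,
    integral_Ioi_tPDF hk, add_comm]

end StudentTail

section LaiBound

variable {m : ℕ} {a : ℝ}

@[fun_prop]
lemma measurable_laiB (m : ℕ) : Measurable (laiB m) := by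
  unfold laiB
  fun_prop

lemma tPDF_mul_sqrt_laiB (hm : 2 ≤ m) (s t : ℝ) :
    tPDF (m - 1) s * √(2 * Real.pi * laiB m s) = tPDF (m - 1) t * √(2 * Real.pi * laiB m t) := by
  have hm1 : (0 : ℝ) < m - 1 := sub_pos.mpr (Nat.one_lt_cast.mpr hm)
  have hcancel (t : ℝ) : (1 + t ^ 2 / ((m : ℝ) - 1)) ^ (-((m : ℝ) / 2)) *
      √((1 + t ^ 2 / ((m : ℝ) - 1)) ^ m) = 1 := by
    rw [Real.sqrt_eq_rpow, ← Real.rpow_natCast_mul (by positivity), mul_one_div,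
      ← Real.rpow_add (by positivity), neg_add_cancel, Real.rpow_zero]
  have hconst (t : ℝ) : tPDF (m - 1) t * √(2 * Real.pi * laiB m t) =
      Real.Gamma (m / 2) / (√((m - 1) * Real.pi) * Real.Gamma ((m - 1) / 2)) *
        √(2 * Real.pi * (1 / m)) := by
    rw [tPDF, laiB, sub_add_cancel, ← mul_assoc (2 * Real.pi),
      Real.sqrt_mul (by positivity) (_ ^ m), mul_mul_mul_comm, mul_assoc, mul_left_comm, hcancel]
    ring
  rw [hconst, hconst]

lemma tPDF_mul_min_sqrt_laiB (hm : 2 ≤ m) (a t : ℝ) :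
    ENNReal.ofReal (tPDF (m - 1) t) * min ((ENNReal.ofReal √(2 * Real.pi * laiB m a))⁻¹ *
      ENNReal.ofReal √(2 * Real.pi * laiB m t)) 1 =
    ENNReal.ofReal (min (tPDF (m - 1) t) (tPDF (m - 1) a)) := by
  have hm1 : (0 : ℝ) < m - 1 := sub_pos.mpr (Nat.one_lt_cast.mpr hm)
  have hB : 0 < √(2 * Real.pi * laiB m a) := by
    have := laiB_pos hm a
    positivity
  have ht := (tPDF_pos hm1 t).le
  rw [← ENNReal.ofReal_inv_of_pos hB, ← ENNReal.ofReal_mul (by positivity), ← ENNReal.ofReal_one,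
    ← ENNReal.ofReal_min, ← ENNReal.ofReal_mul ht, mul_min_of_nonneg _ _ ht, mul_one,
    mul_left_comm, tPDF_mul_sqrt_laiB hm t a, mul_left_comm, inv_mul_cancel₀ hB.ne', mul_one,
    min_comm]

lemma lintegral_min_sqrt_laiB_studentReal (hm : 2 ≤ m) (ha : 0 ≤ a) :
    ∫⁻ t, min ((ENNReal.ofReal √(2 * Real.pi * laiB m a))⁻¹ *
      ENNReal.ofReal √(2 * Real.pi * laiB m t)) 1 ∂studentReal (m - 1) =
    ENNReal.ofReal (2 * (1 - tCDF (m - 1) a + a * tPDF (m - 1) a)) := by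
  have hm1 : (0 : ℝ) < m - 1 := sub_pos.mpr (Nat.one_lt_cast.mpr hm)
  have hmin_nonneg (t : ℝ) : 0 ≤ min (tPDF (m - 1) t) (tPDF (m - 1) a) :=
    le_min (tPDF_pos hm1 t).le (tPDF_pos hm1 a).le
  have hmin_int : Integrable fun t => min (tPDF (m - 1) t) (tPDF (m - 1) a) :=
    (integrable_tPDF hm1).mono' (by fun_prop) <| .of_forall fun t => by
      rw [Real.norm_of_nonneg (hmin_nonneg t)]
      exact min_le_left _ _
  rw [studentReal, lintegral_withDensity_eq_lintegral_mul _ (by fun_prop) (by fun_prop)]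
  simp only [Pi.mul_apply, tPDF_mul_min_sqrt_laiB hm]
  rw [← ofReal_integral_eq_lintegral_ofReal hmin_int (.of_forall hmin_nonneg),
    integral_min_tPDF hm1 ha]

namespace IsIIDGaussian

variable {Ω : Type*} [MeasurableSpace Ω] {P : Measure Ω} {X : ℕ → Ω → ℝ} {v : ℝ≥0}

lemma lintegral_tENSM_comp_eq (h : IsIIDGaussian P X 0 v) (hv : v ≠ 0) (hm : 2 ≤ m)
    {φ : ℝ≥0∞ → ℝ≥0∞} (hφ : Measurable φ) :
    ∫⁻ ω, φ (tENSM m fun i => X i ω) ∂P =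
      ∫⁻ t, φ (ENNReal.ofReal √(2 * Real.pi * laiB m t)) ∂studentReal (m - 1) := by
  have hstat : Measurable fun x : Fin m → ℝ => tStat m (zeroExtend x) :=
    (measurable_avg_zeroExtend.const_mul _).div measurable_sampleVar_zeroExtend.sqrt
  calc ∫⁻ ω, φ (tENSM m fun i => X i ω) ∂P
      = ∫⁻ x, φ (tENSM m (zeroExtend x)) ∂gaussianPi m 0 := by
        refine .trans (lintegral_congr fun ω => ?_)
          (h.lintegral_comp_eq hv (hφ.comp measurable_coneSigma_tENSM))
        rw [tENSM_zeroExtend_restrict fun i => X i ω]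
    _ = ∫⁻ x, φ (ENNReal.ofReal √(2 * Real.pi * laiB m (tStat m (zeroExtend x))))
        ∂gaussianPi m 0 := by
        refine lintegral_congr_ae ?_
        filter_upwards [ae_sampleVar_pos_gaussianPi hm] with x hx
        rw [tENSM_eq_ofReal_sqrt_laiB_tStat hm hx]
    _ = _ := by rw [← map_tStat_gaussianPi hm, lintegral_map (by fun_prop) hstat]

theorem villeBound_tENSM (h : IsIIDGaussian P X 0 v) (hv : v ≠ 0) (hX : ∀ i, Measurable (X i))
    (hm : 2 ≤ m) (ha : 0 ≤ a) :
    villeBound P (fun n ω => tENSM n fun i => X i ω) m (ENNReal.ofReal √(2 * Real.pi * laiB m a)) =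
      ENNReal.ofReal (2 * (1 - tCDF (m - 1) a + a * tPDF (m - 1) a)) := by
  have hb := laiB_pos hm a
  set ε := ENNReal.ofReal √(2 * Real.pi * laiB m a) with hε
  have hε0 : ε ≠ 0 := (ENNReal.ofReal_pos.mpr (by positivity)).ne'
  have hH : Measurable fun ω => tENSM m fun i => X i ω :=
    (measurable_tENSM hX m).mono (Filtration.le _ m) le_rfl
  rw [villeBound_eq_lintegral_min hH hε0 ENNReal.ofReal_ne_top,
    h.lintegral_tENSM_comp_eq hv hm (φ := fun H => min (ε⁻¹ * H) 1) (by fun_prop), hε,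
    lintegral_min_sqrt_laiB_studentReal hm ha]

end IsIIDGaussian
end LaiBound

end TTest

theorem mainTheorem3 {Ω : Type*} [MeasurableSpace Ω] (P : Measure Ω) [IsProbabilityMeasure P]
    (X : ℕ → Ω → ℝ) (hX : ∀ i, Measurable (X i)) :
    -- under every `N(0, v)` with `v > 0`
    (∀ v : ℝ≥0, v ≠ 0 → TTest.IsIIDGaussian P X 0 v →
      -- `H` is an extended nonnegative supermartingale on the scale invariant filtration
      TTest.IsENSM P (TTest.scaleInvFiltration X hX) 1
        (fun n ω => TTest.tENSM n (fun i => X i ω)) ∧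
      -- `H` is the flat mixture of the nonnegative martingales `h_θ`, `θ ∈ ℝ`
      (∀ θ : ℝ, TTest.IsNM P (TTest.scaleInvFiltration X hX) 1
        (fun n ω => TTest.tLR θ n (fun i => X i ω))) ∧
      (∀ n : ℕ, 1 ≤ n → ∀ᵐ ω ∂P,
        TTest.tENSM n (fun i => X i ω) = ∫⁻ θ : ℝ, TTest.tLR θ n (fun i => X i ω)) ∧
      -- the extended Ville inequality for `H`
      (∀ m : ℕ, 1 ≤ m → ∀ ε : ℝ≥0∞, ε ≠ 0 → ε ≠ ∞ →
        P {ω | ∃ n, m ≤ n ∧ ε ≤ TTest.tENSM n (fun i => X i ω)} ≤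
          TTest.villeBound P (fun n ω => TTest.tENSM n (fun i => X i ω)) m ε)) ∧
    -- Lai's confidence sequence, under every `N(μ, v)` with `v > 0`
    (∀ (μ : ℝ) (v : ℝ≥0), v ≠ 0 → TTest.IsIIDGaussian P X μ v →
      ∀ (m : ℕ) (a : ℝ), 2 ≤ m → 0 < a →
        -- exclusion of `μ` is the crossing of the level `√(2πb)` by `H` of the centred data
        (∀ (n : ℕ) (ω : Ω), m ≤ n →
          (μ ∉ TTest.laiCI m a n (fun i => X i ω) ↔
            ENNReal.ofReal (Real.sqrt (2 * Real.pi * TTest.laiB m a)) <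
              TTest.tENSM n (fun i => X i ω - μ))) ∧
        -- the bound of the extended Ville inequality at that level
        P {ω | ∃ n, m ≤ n ∧ μ ∉ TTest.laiCI m a n (fun i => X i ω)} ≤
          TTest.villeBound P (fun n ω => TTest.tENSM n (fun i => X i ω - μ)) m
            (ENNReal.ofReal (Real.sqrt (2 * Real.pi * TTest.laiB m a))) ∧
        TTest.villeBound P (fun n ω => TTest.tENSM n (fun i => X i ω - μ)) m
            (ENNReal.ofReal (Real.sqrt (2 * Real.pi * TTest.laiB m a))) ≤
          ENNReal.ofReal (2 * (1 - TTest.tCDF ((m : ℝ) - 1) a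
            + a * TTest.tPDF ((m : ℝ) - 1) a)) ∧
        -- the error bound of Lai's confidence sequence
        P {ω | ∃ n, m ≤ n ∧ μ ∉ TTest.laiCI m a n (fun i => X i ω)} ≤
          ENNReal.ofReal (2 * (1 - TTest.tCDF ((m : ℝ) - 1) a
            + a * TTest.tPDF ((m : ℝ) - 1) a))) := by
  refine ⟨fun v hv h => ?_, fun μ v hv h m a hm ha => ?_⟩
  · have hH := h.isENSM_tENSM hX hv
    exact ⟨hH, h.isNM_tLR hX hv, fun n hn => h.tENSM_eq_lintegral_tLR hv hn,
      fun m hm ε h0 htop => hH.measure_exists_ge_le_villeBound hm h0 htop⟩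
  · have hY : ∀ i, Measurable fun ω => X i ω - μ := fun i => (hX i).sub_const μ
    have hb := TTest.laiB_pos hm a
    have hiff (n : ℕ) (ω : Ω) (hn : m ≤ n) :=
      TTest.notMem_laiCI_iff hm hn a μ fun i => X i ω
    have hville := (h.sub_const.isENSM_tENSM hY hv).measure_exists_ge_le_villeBound (m := m)
      (by lia) (ENNReal.ofReal_pos.mpr (by positivity : 0 < √(2 * Real.pi * TTest.laiB m a))).ne'
      ENNReal.ofReal_ne_top
    have hcover : P {ω | ∃ n, m ≤ n ∧ μ ∉ TTest.laiCI m a n (fun i => X i ω)} ≤ _ :=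
      hville.trans' (measure_mono fun ω ⟨n, hn, hω⟩ => ⟨n, hn, ((hiff n ω hn).mp hω).le⟩)
    have hbound := h.sub_const.villeBound_tENSM hv hY hm ha.le
    exact ⟨hiff, hcover, hbound.le, hcover.trans hbound.le⟩
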